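/- Let $l\ge 1$, and let $\mathfrak g(C_l^{(1)})=\mathfrak{sp}_{2l}(\mathbb C)\otimes\mathbb C[t,t^{-1}]\oplus\mathbb Cc\oplus\mathbb Cd$ be the affine Lie algebra of type $C_l^{(1)}$, with simple roots $\alpha_0=\delta-2\epsilon_1$, $\alpha_i=\epsilon_i-\epsilon_{i+1}$ $(1\le i<l)$, $\alpha_l=2\epsilon_l$, set of positive roots $\Delta^+$ and root spaces $\mathfrak g_\alpha$. For positive integers $s=(s_0,\dots,s_l)$ put $$Q(s;C_l^{(1)})=F_s\Big(\prod_{\alpha\in\Delta^+}(1-e^{-\alpha})^{\dim\mathfrak g_{-\alpha}}\Big)\in\mathbb C[[q]],$$ where $F_s:\mathbb C[[e^{-\alpha_0},\dots,e^{-\alpha_l}]]\to\mathbb C[[q]]$ is the homomorphism $e^{-\alpha_i}\mapsto q^{s_i}$. The array $\mathcal B^-$ of negative root vectors is the following coloured directed graph. Let the vector crystal of $C_l$ be $1\overset{1}{\to}2\overset{2}{\to}\cdots\overset{l-1}{\to}l\overset{l}{\to}\bar l\overset{l-1}{\to}\cdots\overset{2}{\to}\bar 2\overset{1}{\to}\bar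 1$, with its elements ordered from left to right, of weights $\epsilon_1,\dots,\epsilon_l,-\epsilon_l,\dots,-\epsilon_1$. The nodes are the $xy\otimes t^{-k}$ with $x,y$ in the vector crystal, $y\le x$, and either $k\ge 1$, or $k=0$ and the weight of $xy$ is a negative root of $C_l$. The $i$-arrows, $1\le i\le l$, are the arrows $xy\otimes t^{-k}\to x'y'\otimes t^{-k}$ given by the tensor product rule ($f_i(x\otimes y)=f_ix\otimes y$ if $\varphi_i(x)>\varepsilon_i(y)$, and $x\otimes f_iy$ otherwise, where on the vector crystal $\varphi_i(x)$, resp. $\varepsilon_i(x)$, is $1$ if an $i$-arrow starts, resp. ends, at $x$ and $0$ if not), and the $0$-arrows are $\bar1a\otimes t^{-k}\to a1\otimes t^{-k-1}$. The Chevalley generators are the nodes $f_0=11\otimes t^{-1}$, $f_i=\bar i\,(i+1)\otimes t^0$ $(1\le i<l)$ and $f_l=\bar l\,\bar l\otimes t^0$. The $(s_0,\dots,s_l)$-specialized array $\mathcal N_{C_l^{(1)}}^{(s_0,\dots,s_l)}$ is the labelling of the nodes by non-negative integers for which $f_i$ has label $s_i$ and labels increase by $s_i$ along each $i$-arrow.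 Then the array $\mathcal N_{C_l^{(1)}}^{(1,\dots,1)}$ is well defined (there is exactly one such labelling), and its labels, counted with multiplicity, consist of $l$ copies of the positive integers and one copy of the odd positive integers. Moreover (equivalently), the infinite products involved converge and $$Q(1,\dots,1;C_l^{(1)})=\prod_{i\ge1}(1-q^i)^l\prod_{j\ge1}(1-q^{2j-1}).$$ -/

import Mathlib

open scoped MvPowerSeries.WithPiTopology

noncomputable section

namespace AffineC

/-! ### The affine Lie algebra of type `C_l^{(1)}` -/

/-- The simple Lie algebra `𝔤(C_l)`, realized as the symplectic Lie algebra of rank `l`. -/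
abbrev Sp (l : ℕ) : Type := LieAlgebra.Symplectic.sp (Fin l) ℂ

/-- The trace form of the defining representation. It is the invariant symmetric bilinear form
on `𝔤(C_l)` for which a long root has square length `2`. -/
def form (l : ℕ) : Sp l →ₗ[ℂ] Sp l →ₗ[ℂ] ℂ :=
  LinearMap.mk₂ ℂ (fun x y => Matrix.trace (x.1 * y.1))
    (fun x x' y => by simp [add_mul]) (fun c x y => by simp)
    (fun x y y' => by simp [mul_add]) (fun c x y => by simp)

theorem form_apply {l : ℕ} (x y : Sp l) : form l x y = Matrix.trace (x.1 * y.1) := rfl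

theorem form_comm {l : ℕ} (x y : Sp l) : form l x y = form l y x := by
  rw [form_apply, form_apply, Matrix.trace_mul_comm]

theorem form_lie {l : ℕ} (x y z : Sp l) : form l ⁅x, y⁆ z = form l x ⁅y, z⁆ := by
  simp only [form_apply, LieSubalgebra.coe_bracket, Ring.lie_def, sub_mul, mul_sub,
    Matrix.trace_sub, mul_assoc]
  rw [Matrix.trace_mul_comm y.1 (x.1 * z.1), mul_assoc]

/-- Finitely supported families `∑ x_n ⊗ t^n`, i.e. elements of `𝔤(C_l) ⊗ ℂ[t, t⁻¹]`;
`Finsupp.single n x` is `x ⊗ t^n`. -/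
abbrev Loop (l : ℕ) : Type := ℤ →₀ Sp l

/-- The bracket `[x ⊗ t^m, y ⊗ t^n] = [x, y] ⊗ t^(m+n)` of the loop algebra. -/
def loopBracket (l : ℕ) : Loop l →ₗ[ℂ] Loop l →ₗ[ℂ] Loop l :=
  Finsupp.lsum ℂ fun m => LinearMap.flip (Finsupp.lsum ℂ fun n =>
    LinearMap.flip (LinearMap.mk₂ ℂ (fun x y : Sp l => Finsupp.single (m + n) ⁅x, y⁆)
      (fun x x' y => by simp) (fun c x y => by simp)
      (fun x y y' => by simp) (fun c x y => by simp)))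

/-- The cocycle `(x ⊗ t^m, y ⊗ t^n) ↦ m δ_{m+n,0} ⟨x, y⟩`. -/
def cocycle (l : ℕ) : Loop l →ₗ[ℂ] Loop l →ₗ[ℂ] ℂ :=
  Finsupp.lsum ℂ fun m => LinearMap.flip (Finsupp.lsum ℂ fun n =>
    if m + n = 0 then (m : ℂ) • LinearMap.flip (form l) else 0)

/-- The derivation `x ⊗ t^n ↦ n x ⊗ t^n`. -/
def euler (l : ℕ) : Loop l →ₗ[ℂ] Loop l :=
  Finsupp.lsum ℂ fun n => (n : ℂ) • Finsupp.lsingle n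

@[simp] theorem loopBracket_single {l : ℕ} (m n : ℤ) (x y : Sp l) :
    loopBracket l (Finsupp.single m x) (Finsupp.single n y) = Finsupp.single (m + n) ⁅x, y⁆ := by
  simp [loopBracket]

@[simp] theorem cocycle_single {l : ℕ} (m n : ℤ) (x y : Sp l) :
    cocycle l (Finsupp.single m x) (Finsupp.single n y) =
      if m + n = 0 then (m : ℂ) * form l x y else 0 := by
  simp only [cocycle, Finsupp.lsum_single, LinearMap.flip_apply]
  split_ifs <;> simp

@[simp] theorem euler_single {l : ℕ} (n : ℤ) (x : Sp l) :
    euler l (Finsupp.single n x) = Finsupp.single n ((n : ℂ) • x) := by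
  simp [euler]

theorem loopBracket_skew {l : ℕ} (f g : Loop l) : loopBracket l f g = - loopBracket l g f := by
  induction f using Finsupp.induction_linear with
  | zero => simp
  | add f f' hf hf' => simp only [map_add, LinearMap.add_apply, hf, hf', neg_add]
  | single m x =>
    induction g using Finsupp.induction_linear with
    | zero => simp
    | add g g' hg hg' => simp only [map_add, LinearMap.add_apply, hg, hg', neg_add]
    | single n y =>
      rw [loopBracket_single, loopBracket_single, ← lie_skew, add_comm n m, Finsupp.single_neg]

theorem cocycle_skew {l : ℕ} (f g : Loop l) : cocycle l f g = - cocycle l g f := by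
  induction f using Finsupp.induction_linear with
  | zero => simp
  | add f f' hf hf' => simp only [map_add, LinearMap.add_apply, hf, hf', neg_add]
  | single m x =>
    induction g using Finsupp.induction_linear with
    | zero => simp
    | add g g' hg hg' => simp only [map_add, LinearMap.add_apply, hg, hg', neg_add]
    | single n y =>
      rw [cocycle_single, cocycle_single, add_comm n m, form_comm y x]
      split_ifs with h
      · obtain rfl : n = -m := by omega
        push_cast; ring
      · simp

theorem loopBracket_jacobi {l : ℕ} (f g h : Loop l) :
    loopBracket l f (loopBracket l g h) =
      loopBracket l (loopBracket l f g) h + loopBracket l g (loopBracket l f h) := by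
  induction f using Finsupp.induction_linear with
  | zero => simp
  | add f f' hf hf' => simp only [map_add, LinearMap.add_apply, hf, hf']; abel
  | single m x =>
    induction g using Finsupp.induction_linear with
    | zero => simp
    | add g g' hg hg' => simp only [map_add, LinearMap.add_apply, hg, hg']; abel
    | single n y =>
      induction h using Finsupp.induction_linear with
      | zero => simp
      | add h h' hh hh' => simp only [map_add, hh, hh']; abel
      | single p z =>
        simp only [loopBracket_single]
        rw [leibniz_lie, Finsupp.single_add, add_assoc, add_left_comm n m p]

theorem cocycle_jacobi {l : ℕ} (f g h : Loop l) :
    cocycle l f (loopBracket l g h) =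
      cocycle l (loopBracket l f g) h + cocycle l g (loopBracket l f h) := by
  induction f using Finsupp.induction_linear with
  | zero => simp
  | add f f' hf hf' => simp only [map_add, LinearMap.add_apply, hf, hf']; abel
  | single m x =>
    induction g using Finsupp.induction_linear with
    | zero => simp
    | add g g' hg hg' => simp only [map_add, LinearMap.add_apply, hg, hg']; abel
    | single n y =>
      induction h using Finsupp.induction_linear with
      | zero => simp
      | add h h' hh hh' => simp only [map_add, hh, hh']; abel
      | single p z =>
        simp only [loopBracket_single, cocycle_single, add_assoc, add_left_comm n m p]
        split_ifs with h
        · have h1 : form l y ⁅x, z⁆ = - form l x ⁅y, z⁆ := by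
            rw [← form_lie, ← form_lie, ← lie_skew y x, map_neg, LinearMap.neg_apply]
          rw [form_lie, h1]
          push_cast; ring
        · simp

theorem euler_loopBracket {l : ℕ} (f g : Loop l) :
    euler l (loopBracket l f g) = loopBracket l (euler l f) g + loopBracket l f (euler l g) := by
  induction f using Finsupp.induction_linear with
  | zero => simp
  | add f f' hf hf' => simp only [map_add, LinearMap.add_apply, hf, hf']; abel
  | single m x =>
    induction g using Finsupp.induction_linear with
    | zero => simp
    | add g g' hg hg' => simp only [map_add, hg, hg']; abel
    | single n y =>
      simp only [loopBracket_single, euler_single, smul_lie, lie_smul]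
      rw [← Finsupp.single_add, ← add_smul]
      push_cast; rfl

theorem cocycle_euler {l : ℕ} (f g : Loop l) :
    cocycle l (euler l f) g + cocycle l f (euler l g) = 0 := by
  induction f using Finsupp.induction_linear with
  | zero => simp
  | add f f' hf hf' =>
    simp only [map_add, LinearMap.add_apply]
    linear_combination hf + hf'
  | single m x =>
    induction g using Finsupp.induction_linear with
    | zero => simp
    | add g g' hg hg' =>
      simp only [map_add]
      linear_combination hg + hg'
    | single n y =>
      simp only [euler_single, cocycle_single, map_smul, LinearMap.smul_apply, smul_eq_mul]
      split_ifs with h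
      · obtain rfl : n = -m := by omega
        push_cast; ring
      · simp

/-- The affine Lie algebra `𝔤(C_l^{(1)}) = 𝔤(C_l) ⊗ ℂ[t, t⁻¹] ⊕ ℂ c ⊕ ℂ d`; the element
`⟨f, a, u⟩` is `f + a c + u d`. -/
@[ext] structure Aff (l : ℕ) where
  loop : Loop l
  cent : ℂ
  deg : ℂ

/-- As a vector space, the affine Lie algebra is a product. -/
def Aff.toProd (l : ℕ) : Aff l ≃ Loop l × ℂ × ℂ where
  toFun X := (X.loop, X.cent, X.deg)
  invFun X := ⟨X.1, X.2.1, X.2.2⟩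
  left_inv _ := rfl
  right_inv _ := rfl

instance (l : ℕ) : AddCommGroup (Aff l) := (Aff.toProd l).addCommGroup
instance (l : ℕ) : Module ℂ (Aff l) := (Aff.toProd l).module ℂ

/-- `[x(m), y(n)] = [x, y](m+n) + m δ_{m+n,0} ⟨x, y⟩ c`, `c` is central, `[d, x(n)] = n x(n)`. -/
instance (l : ℕ) : Bracket (Aff l) (Aff l) where
  bracket X Y := ⟨loopBracket l X.loop Y.loop + X.deg • euler l Y.loop - Y.deg • euler l X.loop,
    cocycle l X.loop Y.loop, 0⟩

@[simp] theorem add_loop {l : ℕ} (X Y : Aff l) : (X + Y).loop = X.loop + Y.loop := rfl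
@[simp] theorem add_cent {l : ℕ} (X Y : Aff l) : (X + Y).cent = X.cent + Y.cent := rfl
@[simp] theorem add_deg {l : ℕ} (X Y : Aff l) : (X + Y).deg = X.deg + Y.deg := rfl
@[simp] theorem smul_loop {l : ℕ} (r : ℂ) (X : Aff l) : (r • X).loop = r • X.loop := rfl
@[simp] theorem smul_cent {l : ℕ} (r : ℂ) (X : Aff l) : (r • X).cent = r * X.cent := rfl
@[simp] theorem smul_deg {l : ℕ} (r : ℂ) (X : Aff l) : (r • X).deg = r * X.deg := rfl
@[simp] theorem zero_loop {l : ℕ} : (0 : Aff l).loop = 0 := rfl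
@[simp] theorem zero_cent {l : ℕ} : (0 : Aff l).cent = 0 := rfl
@[simp] theorem zero_deg {l : ℕ} : (0 : Aff l).deg = 0 := rfl
@[simp] theorem lie_loop {l : ℕ} (X Y : Aff l) : (⁅X, Y⁆ : Aff l).loop =
    loopBracket l X.loop Y.loop + X.deg • euler l Y.loop - Y.deg • euler l X.loop := rfl
@[simp] theorem lie_cent {l : ℕ} (X Y : Aff l) :
    (⁅X, Y⁆ : Aff l).cent = cocycle l X.loop Y.loop := rfl
@[simp] theorem lie_deg {l : ℕ} (X Y : Aff l) : (⁅X, Y⁆ : Aff l).deg = 0 := rfl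

theorem loopBracket_self {l : ℕ} (f : Loop l) : loopBracket l f f = 0 := by
  have h : (2 : ℂ) • loopBracket l f f = 0 := by
    rw [two_smul]
    nth_rewrite 1 [loopBracket_skew f f]
    exact neg_add_cancel _
  exact (smul_eq_zero.mp h).resolve_left two_ne_zero

theorem cocycle_self {l : ℕ} (f : Loop l) : cocycle l f f = 0 :=
  self_eq_neg.mp (cocycle_skew f f)

instance (l : ℕ) : LieRing (Aff l) where
  add_lie X Y Z := by
    refine Aff.ext ?_ ?_ ?_
    · simp only [lie_loop, add_loop, add_deg, map_add, LinearMap.add_apply, add_smul, smul_add]; abel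
    · simp
    · simp
  lie_add X Y Z := by
    refine Aff.ext ?_ ?_ ?_
    · simp only [lie_loop, add_loop, add_deg, map_add, add_smul, smul_add]; abel
    · simp
    · simp
  lie_self X := by
    refine Aff.ext ?_ ?_ ?_
    · simp [loopBracket_self]
    · simp [cocycle_self]
    · simp
  leibniz_lie X Y Z := by
    refine Aff.ext ?_ ?_ ?_
    · simp only [lie_loop, add_loop, lie_deg, map_add, map_sub, map_smul, LinearMap.add_apply,
        LinearMap.sub_apply, LinearMap.smul_apply, euler_loopBracket, loopBracket_jacobi X.loop Y.loop,
        smul_add, smul_sub, zero_smul]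
      rw [smul_comm X.deg Y.deg, smul_comm X.deg Z.deg, smul_comm Y.deg Z.deg,
        loopBracket_skew Y.loop (euler l X.loop)]
      simp only [smul_neg]
      abel
    · simp only [lie_loop, add_cent, lie_cent, map_add, map_sub, map_smul, LinearMap.add_apply,
        LinearMap.sub_apply, LinearMap.smul_apply, cocycle_jacobi X.loop Y.loop, smul_eq_mul]
      linear_combination Y.deg * cocycle_euler X.loop Z.loop - X.deg * cocycle_euler Y.loop Z.loop
        - Z.deg * cocycle_euler X.loop Y.loop + Z.deg * cocycle_skew (euler l X.loop) Y.loop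
    · simp

instance (l : ℕ) : LieAlgebra ℂ (Aff l) where
  lie_smul r X Y := by
    refine Aff.ext ?_ ?_ ?_
    · simp only [lie_loop, smul_loop, smul_deg, map_smul, smul_add, smul_sub, mul_smul]
      rw [smul_comm r X.deg]
    · simp
    · simp

/-! ### Roots, root spaces and the specialized Weyl-Kac denominator -/

/-- The element `diag(v, -v)` of the Cartan subalgebra `𝔥` of diagonal matrices in `𝔤(C_l)`. -/
def diagSp (l : ℕ) (v : Fin l → ℂ) : Sp l :=
  ⟨Matrix.diagonal (Sum.elim v (-v)), by
    rw [LieAlgebra.Symplectic.sp, mem_skewAdjointMatricesLieSubalgebra,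
      mem_skewAdjointMatricesSubmodule, Matrix.IsSkewAdjoint, Matrix.IsAdjointPair,
      Matrix.diagonal_transpose]
    ext i j
    rcases i with i | i <;> rcases j with j | j <;>
      simp [Matrix.diagonal_mul, Matrix.mul_diagonal, Matrix.J, Matrix.one_apply] <;>
      by_cases h : i = j <;> simp [h]⟩

/-- Coordinates `(v, a, u)` on the Cartan subalgebra `𝔥 ⊕ ℂ c ⊕ ℂ d` of `𝔤(C_l^{(1)})`. -/
abbrev Cartan (l : ℕ) : Type := (Fin l → ℂ) × ℂ × ℂ

/-- The element `diag(v, -v) ⊗ 1 + a c + u d` of the Cartan subalgebra. -/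
def cartan {l : ℕ} (t : Cartan l) : Aff l := ⟨Finsupp.single 0 (diagSp l t.1), t.2.1, t.2.2⟩

/-- The root space `𝔤_α = {X | [h, X] = α(h) X for all h in the Cartan subalgebra}`. -/
def rootSpace (l : ℕ) (α : Module.Dual ℂ (Cartan l)) : Submodule ℂ (Aff l) where
  carrier := {X | ∀ t : Cartan l, ⁅cartan t, X⁆ = α t • X}
  add_mem' := by
    intro X Y hX hY t
    rw [lie_add, hX t, hY t, smul_add]
  zero_mem' := by intro t; simp
  smul_mem' := by
    intro r X hX t
    rw [lie_smul, hX t, smul_comm]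

/-- The weight `ε_{i+1}`, which takes the value `v_i` on `(v, a, u)` (and `0` if `l ≤ i`). -/
def eps (l i : ℕ) : Module.Dual ℂ (Cartan l) :=
  if h : i < l then (LinearMap.proj ⟨i, h⟩).comp (LinearMap.fst ℂ (Fin l → ℂ) (ℂ × ℂ)) else 0

/-- The imaginary root `δ`, which takes the value `u` on `(v, a, u)`. -/
def delta (l : ℕ) : Module.Dual ℂ (Cartan l) :=
  (LinearMap.snd ℂ ℂ ℂ).comp (LinearMap.snd ℂ (Fin l → ℂ) (ℂ × ℂ))

/-- The simple roots `α_0 = δ - 2ε_1`, `α_i = ε_i - ε_{i+1}` for `1 ≤ i < l`, `α_l = 2ε_l`. -/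
def simpleRoot (l : ℕ) (i : Fin (l + 1)) : Module.Dual ℂ (Cartan l) :=
  if (i : ℕ) = 0 then delta l - (2 : ℂ) • eps l 0
  else if (i : ℕ) = l then (2 : ℂ) • eps l (l - 1)
  else eps l ((i : ℕ) - 1) - eps l (i : ℕ)

/-- The element `∑ k_i α_i` of the positive cone of the root lattice. -/
def latticeElt (l : ℕ) (k : Fin (l + 1) →₀ ℕ) : Module.Dual ℂ (Cartan l) :=
  ∑ i, (k i : ℂ) • simpleRoot l i

/-- The positive roots of `𝔤(C_l^{(1)})`, given by their coefficients in the simple roots (which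
are linearly independent). -/
def PosRoot (l : ℕ) : Type :=
  {k : Fin (l + 1) →₀ ℕ // k ≠ 0 ∧ rootSpace l (latticeElt l k) ≠ ⊥}

/-- The factor `(1 - e^{-α})^{dim 𝔤_{-α}}` of the Weyl-Kac denominator, where the variable `X i`
of the power series ring stands for `e^{-α_i}`. -/
def denominatorFactor (l : ℕ) (k : PosRoot l) : MvPowerSeries (Fin (l + 1)) ℂ :=
  (1 - MvPowerSeries.monomial k.1 1) ^ Module.finrank ℂ (rootSpace l (-latticeElt l k.1))

/-- The denominator `∏_{α ∈ Δ⁺} (1 - e^{-α})^{dim 𝔤_{-α}}` of the Weyl-Kac character formula. -/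
def denominator (l : ℕ) : MvPowerSeries (Fin (l + 1)) ℂ :=
  ∏' k : PosRoot l, denominatorFactor l k

/-- The `s`-specialization `F_s : ℂ⟦e^{-α_0}, …, e^{-α_l}⟧ → ℂ⟦q⟧`, `e^{-α_i} ↦ q^{s_i}`, for
positive integers `s_i`. -/
def specialization {l : ℕ} (s : Fin (l + 1) → ℕ) (F : MvPowerSeries (Fin (l + 1)) ℂ) :
    PowerSeries ℂ :=
  MvPowerSeries.subst (fun i => (PowerSeries.X : PowerSeries ℂ) ^ s i) F

/-- `Q(s; C_l^{(1)})`, the `s`-specialization of the Weyl-Kac denominator. -/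
def Q (l : ℕ) (s : Fin (l + 1) → ℕ) : PowerSeries ℂ := specialization s (denominator l)

/-! ### The array of negative root vectors -/

/-- The `i`-arrows `p → p'` of the crystal of the vector representation of `C_l`,
`1 →¹ 2 →² ⋯ →^{l-1} l →^l l̄ →^{l-1} ⋯ →² 2̄ →¹ 1̄`. The elements `1, …, l, l̄, …, 1̄` are numbered
`0, …, 2l-1` from left to right. -/
def VecArrow (l i : ℕ) (p p' : Fin (2 * l)) : Prop :=
  (p' : ℕ) = p + 1 ∧ i = min ((p : ℕ) + 1) (2 * l - 1 - p)

/-- An `i`-arrow starts at `p`, that is `φ_i(p) = 1`; otherwise `φ_i(p) = 0`. -/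
def Starts (l i : ℕ) (p : Fin (2 * l)) : Prop := ∃ p', VecArrow l i p p'

/-- An `i`-arrow ends at `p`, that is `ε_i(p) = 1`; otherwise `ε_i(p) = 0`. -/
def Ends (l i : ℕ) (p : Fin (2 * l)) : Prop := ∃ p', VecArrow l i p' p

/-- The `i`-arrows `xy → x'y'` of the tensor square of the vector crystal, by the tensor product
rule: `f_i (x ⊗ y)` is `f_i x ⊗ y` if `φ_i(x) > ε_i(y)`, and `x ⊗ f_i y` otherwise. -/
def TensorArrow (l i : ℕ) (x y x' y' : Fin (2 * l)) : Prop :=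
  (Starts l i x ∧ ¬ Ends l i y) ∧ VecArrow l i x x' ∧ y' = y ∨
  ¬ (Starts l i x ∧ ¬ Ends l i y) ∧ x' = x ∧ VecArrow l i y y'

/-- The nodes `xy ⊗ t^{-k}` of the array of negative root vectors of `C_l^{(1)}`. The pairs `xy`
with `y ≤ x` form the crystal of the adjoint representation of `C_l`, a triangle with vertices
`11`, `1̄1`, `1̄1̄`. For `k ≥ 1` the whole triangle occurs. For `k = 0` only the basis of `𝔫₋`
occurs: the weight of `xy` is zero if `x + y = 2l - 1`, and a negative root of `C_l` if
`x + y ≥ 2l`. -/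
structure Node (l : ℕ) where
  x : Fin (2 * l)
  y : Fin (2 * l)
  k : ℕ
  le : y ≤ x
  neg : k = 0 → 2 * l ≤ (x : ℕ) + y

/-- The arrows of the array. The `i`-arrows for `1 ≤ i ≤ l` are those of the triangles, and the
`0`-arrows are `1̄a ⊗ t^{-k} → a1 ⊗ t^{-k-1}`, which glue the triangles along their catheti. -/
def Arrow {l : ℕ} (i : Fin (l + 1)) (u v : Node l) : Prop :=
  if (i : ℕ) = 0 then
    (u.x : ℕ) = 2 * l - 1 ∧ v.x = u.y ∧ (v.y : ℕ) = 0 ∧ v.k = u.k + 1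
  else v.k = u.k ∧ TensorArrow l i u.x u.y v.x v.y

/-- The nodes of the Chevalley generators: `f_0 = 11 ⊗ t^{-1}`, `f_i = ī(i+1) ⊗ t^0` for
`1 ≤ i < l`, and `f_l = l̄l̄ ⊗ t^0`. -/
def IsGenerator {l : ℕ} (i : Fin (l + 1)) (u : Node l) : Prop :=
  if (i : ℕ) = 0 then (u.x : ℕ) = 0 ∧ (u.y : ℕ) = 0 ∧ u.k = 1
  else (u.x : ℕ) = 2 * l - (i : ℕ) ∧ (u.y : ℕ) = (i : ℕ) ∧ u.k = 0

/-- `N` is the labelling of the nodes in the `(s_0, …, s_l)`-specialized weighted array: `f_i` has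
label `s_i`, and labels increase by `s_i` along every `i`-arrow. -/
def IsSpecializedArray {l : ℕ} (s : Fin (l + 1) → ℕ) (N : Node l → ℕ) : Prop :=
  (∀ i u, IsGenerator i u → N u = s i) ∧ ∀ i u v, Arrow i u v → N v = N u + s i

end AffineC

end

noncomputable section

namespace AffineC

/-! ### Infinite products of power series -/

section Products

variable {σ R ι : Type*} [CommRing R] [TopologicalSpace R]

/-! With crystal elements numbered `0, …, 2l-1`, the label of `xy ⊗ t^{-k}` must be `x + y + 1 +
2l(k-1)`. A tensor arrow raises `x + y` by one; a `0`-arrow lowers it by `2l - 1` and raises `k` by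
one; the generators have value `1`. Every node is reached from a generator (`Node.induction`), so
this labelling is the only one.

Counting: put `n = 2lq + r` with `0 ≤ r < 2l`. The nodes of label `n + 1` are the pairs `y ≤ x` with
`x + y = r`, `k = q + 1`, or with `x + y = 2l + r`, `k = q`. There are `⌊r/2⌋ + 1` of the first kind
and `l + ⌊r/2⌋ - r` of the second, hence `l + 1` in all for `n` even and `l` for `n` odd
(`bijective_nodeOfLabel`).

For the product, `M ↦ MJ` identifies the symplectic algebra with the symmetric square of its
defining representation, so the `xy ⊗ t^m` with `y ≤ x` give bases of all root spaces of nonzero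
weight (`finrank_rootSpace`). The nodes with a given positive root thus index a basis of the root
space of its negative, imaginary roots included, and the denominator is a product over nodes
(`hasProd_denominatorFactor`). The principal specialization is a continuous algebra map sending the
factor of a node to `1 - q^label`, because the label is the height of the root
(`Node.root_heightCoweight`). -/

theorem multipliable_one_sub_of_finite_order_le {f : ι → MvPowerSeries σ R}
    (h : ∀ n : ℕ, {i | (f i).order ≤ n}.Finite) : Multipliable fun i => 1 - f i := by
  have key : Summable (fun s : Finset ι => ∏ i ∈ s, -f i) := by
    -- The order of a product is at least the sum of the orders, so the coefficient at `d` only sees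
    -- finite sets whose members all have order at most the degree of `d`. There are finitely many
    -- such sets.
    refine MvPowerSeries.WithPiTopology.summable_iff_summable_coeff.mpr fun d =>
      summable_of_hasFiniteSupport ?_
    refine (((h d.degree).toFinset.powerset).finite_toSet).subset fun s hs => ?_
    rw [Function.mem_support] at hs
    rw [Finset.mem_coe, Finset.mem_powerset]
    intro i hi
    rw [Set.Finite.mem_toFinset, Set.mem_ofPred_eq]
    contrapose! hs
    refine MvPowerSeries.coeff_of_lt_order (hs.trans_le ?_)
    refine le_trans ?_ (MvPowerSeries.le_order_prod _ _)
    rw [← MvPowerSeries.order_neg]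
    exact Finset.single_le_sum (f := fun i => (-f i).order) (by simp) hi
  simpa only [sub_eq_add_neg] using multipliable_one_add_of_summable_prod key

theorem multipliable_one_sub_monomial [Nontrivial R] {d : ι → σ →₀ ℕ}
    (h : ∀ n : ℕ, {i | (d i).degree ≤ n}.Finite) :
    Multipliable fun i => 1 - MvPowerSeries.monomial (d i) (1 : R) := by
  refine multipliable_one_sub_of_finite_order_le fun n => (h n).subset fun i hi => ?_
  rw [Set.mem_ofPred_eq, MvPowerSeries.order_monomial_of_ne_zero one_ne_zero] at hi
  exact_mod_cast hi

theorem multipliable_one_sub_X_pow [Nontrivial R] {d : ι → ℕ}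
    (h : ∀ n : ℕ, {i | d i ≤ n}.Finite) :
    Multipliable fun i => 1 - (PowerSeries.X : PowerSeries R) ^ d i := by
  have := multipliable_one_sub_monomial (R := R) (d := fun i => Finsupp.single () (d i))
    (by simpa using h)
  simpa only [PowerSeries.X_pow_eq] using! this

end Products

/-! ### The principal specialization -/

/-- The exponent `1` is left unsimplified to match the body of `specialization` at the constant
family `1`. -/
theorem hasSubst_principal (l : ℕ) : MvPowerSeries.HasSubst
    (fun _ : Fin (l + 1) => (PowerSeries.X : PowerSeries ℂ) ^ 1) :=
  MvPowerSeries.hasSubst_of_constantCoeff_zero fun _ => by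
    rw [pow_one]; exact PowerSeries.constantCoeff_X

theorem prod_principal {l : ℕ} (d : Fin (l + 1) →₀ ℕ) :
    d.prod (fun _ n => ((PowerSeries.X : PowerSeries ℂ) ^ 1) ^ n) = PowerSeries.X ^ d.degree := by
  simp only [pow_one, Finsupp.prod, Finset.prod_pow_eq_pow_sum, Finsupp.degree_apply]

theorem specialization_one_sub_monomial {l : ℕ} (d : Fin (l + 1) →₀ ℕ) :
    specialization (fun _ => 1) (1 - MvPowerSeries.monomial d 1) =
      1 - (PowerSeries.X : PowerSeries ℂ) ^ d.degree := by
  rw [specialization, MvPowerSeries.subst_sub (hasSubst_principal l),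
    MvPowerSeries.subst_monomial (hasSubst_principal l), prod_principal,
    ← MvPowerSeries.coe_substAlgHom (hasSubst_principal l), map_one, map_one, one_mul]

/-- Only finitely many exponent vectors have a given degree. Finiteness of this sum is what makes
the specialization continuous, hence compatible with infinite products. -/
theorem coeff_specialization {l : ℕ} (F : MvPowerSeries (Fin (l + 1)) ℂ) (n : ℕ) :
    PowerSeries.coeff n (specialization (fun _ => 1) F) =
      ∑ d ∈ Finset.univ.finsuppAntidiag n, MvPowerSeries.coeff d F := by
  rw [specialization, PowerSeries.coeff, MvPowerSeries.coeff_subst (hasSubst_principal l)]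
  simp only [prod_principal]
  have h (d : Fin (l + 1) →₀ ℕ) : MvPowerSeries.coeff (Finsupp.single () n)
      ((PowerSeries.X : PowerSeries ℂ) ^ d.degree) = if n = d.degree then 1 else 0 :=
    PowerSeries.coeff_X_pow n d.degree
  simp only [h]
  have hmem (d : Fin (l + 1) →₀ ℕ) :
      d ∈ (Finset.univ : Finset (Fin (l + 1))).finsuppAntidiag n ↔ n = d.degree := by
    simp [Finset.mem_finsuppAntidiag, Finsupp.degree_eq_sum, eq_comm]
  rw [finsum_eq_sum_of_support_subset (s := Finset.univ.finsuppAntidiag n)]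
  · refine Finset.sum_congr rfl fun d hd => ?_
    simp [(hmem d).mp hd]
  · intro d hd
    rw [Finset.mem_coe, hmem]
    by_contra hne
    simp [hne] at hd

theorem continuous_specialization (l : ℕ) :
    Continuous (specialization fun _ : Fin (l + 1) => 1) := by
  rw [continuous_iff_continuousAt]
  intro F
  rw [ContinuousAt, PowerSeries.WithPiTopology.tendsto_iff_coeff_tendsto]
  intro n
  simp only [coeff_specialization]
  exact (continuous_finsetSum _ fun d _ =>
    MvPowerSeries.WithPiTopology.continuous_coeff ℂ d).tendsto F

theorem hasProd_specialization {l : ℕ} {ι : Type*} {f : ι → MvPowerSeries (Fin (l + 1)) ℂ}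
    {F : MvPowerSeries (Fin (l + 1)) ℂ} (h : HasProd f F) :
    HasProd (fun i => specialization (fun _ => 1) (f i)) (specialization (fun _ => 1) F) := by
  have := h.map (MvPowerSeries.substAlgHom (hasSubst_principal l)) (by
    rw [MvPowerSeries.coe_substAlgHom]; exact continuous_specialization l)
  simpa only [MvPowerSeries.coe_substAlgHom] using! this

/-! ### The principally specialized array -/

/-- The height of the positive root attached to the node `xy ⊗ t^{-k}`. -/
def Node.height {l : ℕ} (u : Node l) : ℕ := u.x + u.y + 1 + 2 * l * u.k - 2 * l

/-- The truncated subtraction in `Node.height` loses nothing: either `k ≥ 1`, or `k = 0` and `x + y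
≥ 2l`. -/
theorem Node.height_add {l : ℕ} (u : Node l) :
    u.height + 2 * l = u.x + u.y + 1 + 2 * l * u.k := by
  have := u.neg
  rw [Node.height]
  rcases Nat.eq_zero_or_pos u.k with h | h
  · have := this h; omega
  · have := Nat.le_mul_of_pos_right (2 * l) h; omega

theorem Node.height_pos {l : ℕ} (u : Node l) : 0 < u.height := by
  have := u.height_add
  have := u.neg
  rcases Nat.eq_zero_or_pos u.k with h | h
  · have := this h; omega
  · have := Nat.le_mul_of_pos_right (2 * l) h; omega

theorem VecArrow.succ {l i : ℕ} {p p' : Fin (2 * l)} (h : VecArrow l i p p') :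
    (p' : ℕ) = p + 1 := h.1

theorem TensorArrow.add_succ {l i : ℕ} {x y x' y' : Fin (2 * l)} (h : TensorArrow l i x y x' y') :
    (x' : ℕ) + y' = x + y + 1 := by
  rcases h with ⟨_, h, rfl⟩ | ⟨_, rfl, h⟩ <;> have := h.succ <;> omega

theorem Arrow.height_eq {l : ℕ} {i : Fin (l + 1)} {u v : Node l} (h : Arrow i u v) :
    v.height = u.height + 1 := by
  have hu := u.height_add
  have hv := v.height_add
  rw [Arrow] at h
  split_ifs at h with hi
  · obtain ⟨h1, h2, h3, h4⟩ := h
    rw [h4, mul_add, mul_one, h2, h3] at hv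
    omega
  · obtain ⟨h1, h2⟩ := h
    have := h2.add_succ
    rw [h1] at hv
    omega

theorem IsGenerator.height_eq {l : ℕ} {i : Fin (l + 1)} {u : Node l} (h : IsGenerator i u) :
    u.height = 1 := by
  have hu := u.height_add
  have := i.2
  rw [IsGenerator] at h
  split_ifs at h with hi
  · obtain ⟨h1, h2, h3⟩ := h
    rw [h3] at hu
    omega
  · obtain ⟨h1, h2, h3⟩ := h
    rw [h3] at hu
    omega

theorem isSpecializedArray_height (l : ℕ) :
    IsSpecializedArray (fun _ : Fin (l + 1) => 1) (Node.height (l := l)) :=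
  ⟨fun _ _ h => h.height_eq, fun _ _ _ h => h.height_eq⟩

/-- Every pair other than `11` is the target of an arrow of the crystal of the adjoint
representation. -/
theorem exists_tensorArrow {l : ℕ} (x y : Fin (2 * l)) (hyx : y ≤ x) (h : 0 < (x : ℕ) + y) :
    ∃ i : ℕ, 1 ≤ i ∧ i ≤ l ∧ ∃ x' y' : Fin (2 * l), y' ≤ x' ∧ TensorArrow l i x' y' x y := by
  have hx := x.2
  have hy := y.2
  rw [Fin.le_def] at hyx
  -- The arrow ending at `p ≥ 1` has colour `min p (2l - p)`. If no arrow of the colour entering `x`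
  -- ends at `y`, the tensor rule lets `x` be stepped back. Otherwise `y` is stepped back: the arrow
  -- leaving `x` never has the colour of the one entering it, so the rule acts on the second factor.
  by_cases hc : (y : ℕ) = 0 ∨ min (x : ℕ) (2 * l - x) ≠ min (y : ℕ) (2 * l - y)
  · have hlt : (y : ℕ) < x := by
      rcases hc with hc | hc
      · omega
      · by_contra hn
        exact hc (by rw [show (x : ℕ) = y by omega])
    refine ⟨min x (2 * l - x), by omega, by omega, ⟨x - 1, by omega⟩, y, ?_,
      Or.inl ⟨⟨⟨x, ?_⟩, ?_⟩, ?_, rfl⟩⟩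
    · rw [Fin.le_def]; simp only; omega
    · constructor <;> simp only <;> omega
    · rintro ⟨p, hp, hp'⟩
      omega
    · constructor <;> simp only <;> omega
  · push Not at hc
    refine ⟨min y (2 * l - y), by omega, by omega, x, ⟨y - 1, by omega⟩, ?_, Or.inr ⟨?_, rfl, ?_⟩⟩
    · rw [Fin.le_def]; simp only; omega
    · rintro ⟨⟨p, hp, hp'⟩, _⟩
      omega
    · constructor <;> simp only <;> omega

/-- Every node of the array is reached from the Chevalley generators along arrows. -/
theorem Node.induction {l : ℕ} {P : Node l → Prop} (hgen : ∀ i u, IsGenerator i u → P u)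
    (harrow : ∀ i u v, Arrow i u v → P u → P v) (v : Node l) : P v := by
  induction hn : v.height generalizing v with
  | zero => have := v.height_pos; omega
  | succ n ih =>
    suffices h : (∃ i, IsGenerator i v) ∨ ∃ i u, Arrow i u v by
      rcases h with ⟨i, h⟩ | ⟨i, u, h⟩
      · exact hgen i v h
      · exact harrow i u v h (ih u (by have := h.height_eq; omega))
    obtain ⟨x, y, k, hyx, hneg⟩ := v
    have hx := x.2
    have hy := y.2
    by_cases hk : k = 0
    · subst hk
      have hxy := hneg rfl
      rw [Fin.le_def] at hyx
      -- In the layer `k = 0` the hypotenuse `x + y = 2l` consists of the generators `f_y`. Beyond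
      -- it, a predecessor still has `x' + y' ≥ 2l` and so belongs to the array.
      by_cases hs : (x : ℕ) + y = 2 * l
      · refine Or.inl ⟨⟨y, by omega⟩, ?_⟩
        rw [IsGenerator, if_neg (by simp only; omega)]
        refine ⟨?_, rfl, rfl⟩
        simp only; omega
      · obtain ⟨i, hi, hil, x', y', hle, ha⟩ := exists_tensorArrow x y hyx (by omega)
        have := ha.add_succ
        refine Or.inr ⟨⟨i, by omega⟩, ⟨x', y', 0, hle, fun _ => by omega⟩, ?_⟩
        rw [Arrow, if_neg (by simp only; omega)]
        exact ⟨rfl, ha⟩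
    · by_cases hs : (x : ℕ) + y = 0
      · by_cases hk1 : k = 1
        · refine Or.inl ⟨0, ?_⟩
          rw [IsGenerator, if_pos (Fin.val_zero _)]
          refine ⟨?_, ?_, hk1⟩ <;> simp only <;> omega
        · refine Or.inr ⟨0, ⟨⟨2 * l - 1, by omega⟩, x, k - 1, ?_, fun h => by omega⟩, ?_⟩
          · rw [Fin.le_def]; simp only; omega
          · rw [Arrow, if_pos (Fin.val_zero _)]
            refine ⟨rfl, rfl, ?_, ?_⟩ <;> simp only <;> omega
      · obtain ⟨i, hi, hil, x', y', hle, ha⟩ := exists_tensorArrow x y hyx (by omega)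
        refine Or.inr ⟨⟨i, by omega⟩, ⟨x', y', k, hle, fun h => absurd h hk⟩, ?_⟩
        rw [Arrow, if_neg (by simp only; omega)]
        exact ⟨rfl, ha⟩

theorem IsSpecializedArray.eq_height {l : ℕ} {N : Node l → ℕ}
    (hN : IsSpecializedArray (fun _ : Fin (l + 1) => 1) N) : N = Node.height := by
  funext v
  refine Node.induction (P := fun v => N v = v.height) ?_ ?_ v
  · intro i u h
    rw [hN.1 i u h, h.height_eq]
  · intro i u v h ih
    rw [hN.2 i u v h, h.height_eq, ih]

/-! ### Enumeration of the nodes of given height -/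

/-- The `j`-th node of height `n + 1`. There are `l + 1` of them if `n` is even, and `l` if `n` is
odd. -/
def nodeAt (l j n : ℕ) (hl : 1 ≤ l) (hj : j < l ∨ j = l ∧ Even n) : Node l :=
  have hr : n % (2 * l) < 2 * l := Nat.mod_lt _ (by omega)
  -- As `2l` is even, `n` and its remainder have the same parity. For `j = l` an odd remainder would
  -- violate `y ≤ x` below.
  have he : j = l → n % (2 * l) % 2 = 0 := fun h => by
    rw [Nat.mod_mul_right_mod]
    rcases hj with h' | h'
    · omega
    · exact Nat.even_iff.mp h'.2
  -- With `r = n % (2l)`, the first branch runs over `x + y = r` by `y = j`; the second runs over `x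
  -- + y = 2l + r`, with `x` descending from `2l - 1` at `j = ⌊r/2⌋ + 1`.
  if h : j ≤ n % (2 * l) / 2 then
    { x := ⟨n % (2 * l) - j, by omega⟩
      y := ⟨j, by omega⟩
      k := n / (2 * l) + 1
      le := show j ≤ n % (2 * l) - j by omega
      neg := fun h => absurd h (Nat.succ_ne_zero _) }
  else
    { x := ⟨2 * l + n % (2 * l) / 2 - j, by omega⟩
      y := ⟨j + n % (2 * l) - n % (2 * l) / 2, by omega⟩
      k := n / (2 * l)
      le := by rw [Fin.le_def]; simp only; omega
      neg := fun _ => by simp only; omega }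

theorem nodeAt_of_le {l j n : ℕ} {hl : 1 ≤ l} {hj : j < l ∨ j = l ∧ Even n}
    (h : j ≤ n % (2 * l) / 2) :
    ((nodeAt l j n hl hj).x : ℕ) = n % (2 * l) - j ∧ ((nodeAt l j n hl hj).y : ℕ) = j ∧
      (nodeAt l j n hl hj).k = n / (2 * l) + 1 := by
  rw [nodeAt, dif_pos h]
  exact ⟨rfl, rfl, rfl⟩

theorem nodeAt_of_lt {l j n : ℕ} {hl : 1 ≤ l} {hj : j < l ∨ j = l ∧ Even n}
    (h : ¬ j ≤ n % (2 * l) / 2) :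
    ((nodeAt l j n hl hj).x : ℕ) = 2 * l + n % (2 * l) / 2 - j ∧
      ((nodeAt l j n hl hj).y : ℕ) = j + n % (2 * l) - n % (2 * l) / 2 ∧
      (nodeAt l j n hl hj).k = n / (2 * l) := by
  rw [nodeAt, dif_neg h]
  exact ⟨rfl, rfl, rfl⟩

theorem height_nodeAt {l j n : ℕ} (hl : 1 ≤ l) (hj : j < l ∨ j = l ∧ Even n) :
    (nodeAt l j n hl hj).height = n + 1 := by
  have h := (nodeAt l j n hl hj).height_add
  have hd := Nat.mod_add_div n (2 * l)
  by_cases hc : j ≤ n % (2 * l) / 2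
  · obtain ⟨h1, h2, h3⟩ := nodeAt_of_le (hl := hl) (hj := hj) hc
    rw [h3, mul_add, mul_one] at h
    omega
  · obtain ⟨h1, h2, h3⟩ := nodeAt_of_lt (hl := hl) (hj := hj) hc
    rw [h3] at h
    omega

theorem nodeAt_inj {l j j' n n' : ℕ} {hl : 1 ≤ l} {hj : j < l ∨ j = l ∧ Even n}
    {hj' : j' < l ∨ j' = l ∧ Even n'} (h : nodeAt l j n hl hj = nodeAt l j' n' hl hj') :
    j = j' ∧ n = n' := by
  have hn : n = n' := by
    have := congrArg Node.height h
    rwa [height_nodeAt, height_nodeAt, add_left_inj] at this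
  subst hn
  refine ⟨?_, rfl⟩
  by_cases hc : j ≤ n % (2 * l) / 2 <;> by_cases hc' : j' ≤ n % (2 * l) / 2
  · have h1 := nodeAt_of_le (hl := hl) (hj := hj) hc
    have h2 := nodeAt_of_le (hl := hl) (hj := hj') hc'
    rw [h] at h1; omega
  · have h1 := nodeAt_of_le (hl := hl) (hj := hj) hc
    have h2 := nodeAt_of_lt (hl := hl) (hj := hj') hc'
    rw [h] at h1; omega
  · have h1 := nodeAt_of_lt (hl := hl) (hj := hj) hc
    have h2 := nodeAt_of_le (hl := hl) (hj := hj') hc'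
    rw [h] at h1; omega
  · have h1 := nodeAt_of_lt (hl := hl) (hj := hj) hc
    have h2 := nodeAt_of_lt (hl := hl) (hj := hj') hc'
    rw [h] at h1; omega

theorem Node.ext_of_coe {l : ℕ} {u v : Node l} (hx : (u.x : ℕ) = v.x) (hy : (u.y : ℕ) = v.y)
    (hk : u.k = v.k) : u = v := by
  obtain ⟨x, y, k, _, _⟩ := u
  obtain ⟨x', y', k', _, _⟩ := v
  obtain rfl : x = x' := Fin.ext hx
  obtain rfl : y = y' := Fin.ext hy
  obtain rfl : k = k' := hk
  rfl

theorem exists_eq_nodeAt {l : ℕ} (hl : 1 ≤ l) (u : Node l) :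
    ∃ j n, ∃ hj : j < l ∨ j = l ∧ Even n, u = nodeAt l j n hl hj := by
  have hx := u.x.2
  have hy := u.y.2
  have hle := u.le
  rw [Fin.le_def] at hle
  by_cases hs : (u.x : ℕ) + u.y < 2 * l
  · have hk : u.k ≠ 0 := fun h => by have := u.neg h; omega
    have hmod : (u.x + u.y + 2 * l * (u.k - 1)) % (2 * l) = u.x + u.y := by
      rw [Nat.add_mul_mod_self_left, Nat.mod_eq_of_lt hs]
    have hdiv : (u.x + u.y + 2 * l * (u.k - 1)) / (2 * l) = u.k - 1 := by
      rw [Nat.add_mul_div_left _ _ (by omega), Nat.div_eq_of_lt hs, zero_add]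
    refine ⟨u.y, u.x + u.y + 2 * l * (u.k - 1), Or.inl (by omega), ?_⟩
    obtain ⟨h1, h2, h3⟩ := nodeAt_of_le (l := l) (j := u.y) (n := u.x + u.y + 2 * l * (u.k - 1))
      (hl := hl) (hj := Or.inl (by omega)) (by omega)
    exact Node.ext_of_coe (by omega) (by omega) (by omega)
  · obtain ⟨r, hr⟩ : ∃ r : ℕ, (u.x : ℕ) + u.y = 2 * l + r := ⟨u.x + u.y - 2 * l, by omega⟩
    have hrl : r < 2 * l := by omega
    have hmod : (r + 2 * l * u.k) % (2 * l) = r := by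
      rw [Nat.add_mul_mod_self_left, Nat.mod_eq_of_lt hrl]
    have hdiv : (r + 2 * l * u.k) / (2 * l) = u.k := by
      rw [Nat.add_mul_div_left _ _ (by omega), Nat.div_eq_of_lt hrl, zero_add]
    -- From `2y ≤ x + y = 2l + r` the index is at most `l`, and equality forces `r` to be even.
    have hj : u.y + r / 2 - r < l ∨ u.y + r / 2 - r = l ∧ Even (r + 2 * l * u.k) := by
      by_cases h : u.y + r / 2 - r < l
      · exact Or.inl h
      · refine Or.inr ⟨by omega, ?_⟩
        rw [mul_assoc, Nat.even_add]
        simp only [even_two_mul, iff_true]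
        rw [Nat.even_iff]
        omega
    refine ⟨u.y + r / 2 - r, r + 2 * l * u.k, hj, ?_⟩
    obtain ⟨h1, h2, h3⟩ := nodeAt_of_lt (l := l) (j := u.y + r / 2 - r) (n := r + 2 * l * u.k)
      (hl := hl) (hj := hj) (by omega)
    exact Node.ext_of_coe (by omega) (by omega) (by omega)

/-- The nodes correspond to `l` copies of the positive integers and one copy of the odd positive
integers. -/
def nodeOfLabel (l : ℕ) (hl : 1 ≤ l) : (Fin l × ℕ+) ⊕ {n : ℕ // Odd n} → Node l :=
  Sum.elim (fun p => nodeAt l p.1 (p.2 - 1) hl (Or.inl p.1.2))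
    (fun n => nodeAt l l (n.1 - 1) hl (Or.inr ⟨rfl, Nat.Odd.sub_odd n.2 odd_one⟩))

theorem height_nodeOfLabel {l : ℕ} (hl : 1 ≤ l) (z : (Fin l × ℕ+) ⊕ {n : ℕ // Odd n}) :
    (nodeOfLabel l hl z).height = Sum.elim (fun p : Fin l × ℕ+ => (p.2 : ℕ))
      (fun n : {n : ℕ // Odd n} => n.1) z := by
  rcases z with ⟨j, n⟩ | ⟨n, hn⟩
  · have := n.pos
    simp only [nodeOfLabel, Sum.elim_inl, height_nodeAt]
    omega
  · have := hn.pos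
    simp only [nodeOfLabel, Sum.elim_inr, height_nodeAt]
    omega

theorem bijective_nodeOfLabel (l : ℕ) (hl : 1 ≤ l) : Function.Bijective (nodeOfLabel l hl) := by
  constructor
  · rintro (⟨j, n⟩ | ⟨n, hn⟩) (⟨j', n'⟩ | ⟨n', hn'⟩) h <;>
      simp only [nodeOfLabel, Sum.elim_inl, Sum.elim_inr] at h <;>
      obtain ⟨h1, h2⟩ := nodeAt_inj h
    · have := n.pos
      have := n'.pos
      obtain rfl : j = j' := Fin.ext h1
      obtain rfl : n = n' := PNat.eq (by omega)
      rfl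
    · have := j.2; omega
    · have := j'.2; omega
    · have := hn.pos
      have := hn'.pos
      obtain rfl : n = n' := by omega
      rfl
  · intro u
    obtain ⟨j, n, hj, rfl⟩ := exists_eq_nodeAt hl u
    by_cases h : j < l
    · exact ⟨Sum.inl (⟨j, h⟩, n.succPNat), rfl⟩
    · obtain ⟨rfl, hn⟩ : j = l ∧ Even n := by tauto
      exact ⟨Sum.inr ⟨n + 1, hn.add_one⟩, rfl⟩

/-- The nodes, with their heights, form `l` copies of the positive integers and one copy of the odd
positive integers. -/
def nodeEquiv (l : ℕ) (hl : 1 ≤ l) : Node l ≃ (Fin l × ℕ+) ⊕ {n : ℕ // Odd n} :=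
  (Equiv.ofBijective _ (bijective_nodeOfLabel l hl)).symm

theorem elim_nodeEquiv {l : ℕ} (hl : 1 ≤ l) (u : Node l) :
    Sum.elim (fun p : Fin l × ℕ+ => (p.2 : ℕ)) (fun n : {n : ℕ // Odd n} => n.1)
      (nodeEquiv l hl u) = u.height := by
  rw [← height_nodeOfLabel hl]
  exact congrArg Node.height (Equiv.ofBijective_apply_symm_apply _ (bijective_nodeOfLabel l hl) u)

theorem finite_label_le (l n : ℕ) : {z | Sum.elim (fun p : Fin l × ℕ+ => (p.2 : ℕ))
    (fun n : {n : ℕ // Odd n} => n.1) z ≤ n}.Finite := by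
  have h1 : {m : ℕ+ | (m : ℕ) ≤ n}.Finite :=
    (Set.finite_Iic n).preimage PNat.coe_injective.injOn
  have h2 : {m : {n : ℕ // Odd n} | m.1 ≤ n}.Finite :=
    (Set.finite_Iic n).preimage Subtype.coe_injective.injOn
  refine (((Set.finite_univ.prod h1).image Sum.inl).union (h2.image Sum.inr)).subset ?_
  rintro (⟨j, m⟩ | m) hz
  · exact Or.inl ⟨(j, m), ⟨trivial, hz⟩, rfl⟩
  · exact Or.inr ⟨m, hz, rfl⟩

theorem finite_height_le {l : ℕ} (hl : 1 ≤ l) (n : ℕ) : {u : Node l | u.height ≤ n}.Finite := by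
  refine ((finite_label_le l n).preimage (nodeEquiv l hl).injective.injOn).subset fun u hu => ?_
  rw [Set.mem_preimage, Set.mem_ofPred_eq, elim_nodeEquiv]
  exact hu

theorem finite_pnat_mul_sub_one_le (n : ℕ) : {j : ℕ+ | 2 * (j : ℕ) - 1 ≤ n}.Finite :=
  ((Set.finite_Iic (n + 1)).preimage PNat.coe_injective.injOn).subset fun j hj => by
    rw [Set.mem_ofPred_eq] at hj
    rw [Set.mem_preimage, Set.mem_Iic]
    omega

theorem multipliable_one_sub_X_pow_odd :
    Multipliable fun j : ℕ+ => (1 - PowerSeries.X ^ (2 * (j : ℕ) - 1) : PowerSeries ℂ) :=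
  multipliable_one_sub_X_pow finite_pnat_mul_sub_one_le

theorem hasProd_one_sub_X_pow_pow (l : ℕ) :
    HasProd (fun i : ℕ+ => (1 - PowerSeries.X ^ (i : ℕ) : PowerSeries ℂ) ^ l)
      (∏' p : Fin l × ℕ+, (1 - PowerSeries.X ^ (p.2 : ℕ))) := by
  have h : Multipliable fun p : Fin l × ℕ+ => (1 - PowerSeries.X ^ (p.2 : ℕ) : PowerSeries ℂ) := by
    refine multipliable_one_sub_X_pow (d := fun p : Fin l × ℕ+ => (p.2 : ℕ)) fun n => ?_
    exact (finite_label_le l n).preimage (f := Sum.inl) Sum.inl_injective.injOn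
  -- Grouping the pairs by their integer leaves `l` equal factors in each fibre.
  refine HasProd.prod_fiberwise ((Equiv.prodComm ℕ+ (Fin l)).hasProd_iff.mpr h.hasProd) fun i => ?_
  have := hasProd_fintype fun _ : Fin l => (1 - PowerSeries.X ^ (i : ℕ) : PowerSeries ℂ)
  rwa [Finset.prod_const, Finset.card_univ, Fintype.card_fin] at this

/-- The odd positive integers are the numbers `2j - 1` with `j` positive. -/
def oddEquiv : ℕ+ ≃ {n : ℕ // Odd n} where
  toFun j := ⟨2 * j - 1, by have := j.pos; exact ⟨j - 1, by omega⟩⟩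
  invFun n := ⟨(n.1 + 1) / 2, by have := n.2.pos; omega⟩
  left_inv j := PNat.eq (by have := j.pos; simp only [PNat.mk_coe]; omega)
  right_inv n := Subtype.ext (by obtain ⟨m, hm⟩ := n.2; simp only [PNat.mk_coe]; omega)

theorem tprod_one_sub_X_pow_height {l : ℕ} (hl : 1 ≤ l) :
    ∏' u : Node l, (1 - PowerSeries.X ^ u.height : PowerSeries ℂ) =
      (∏' i : ℕ+, (1 - PowerSeries.X ^ (i : ℕ) : PowerSeries ℂ) ^ l) *
        ∏' j : ℕ+, (1 - PowerSeries.X ^ (2 * (j : ℕ) - 1) : PowerSeries ℂ) := by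
  have hodd : ∏' j : ℕ+, (1 - PowerSeries.X ^ (2 * (j : ℕ) - 1) : PowerSeries ℂ) =
      ∏' n : {n : ℕ // Odd n}, (1 - PowerSeries.X ^ n.1) :=
    oddEquiv.tprod_eq fun n => (1 - PowerSeries.X ^ n.1 : PowerSeries ℂ)
  rw [(hasProd_one_sub_X_pow_pow l).tprod_eq, hodd]
  simp only [← elim_nodeEquiv hl]
  rw [(nodeEquiv l hl).tprod_eq fun z => (1 - PowerSeries.X ^ (Sum.elim
    (fun p : Fin l × ℕ+ => (p.2 : ℕ)) (fun n : {n : ℕ // Odd n} => n.1) z) : PowerSeries ℂ)]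
  refine Multipliable.tprod_sum ?_ ?_
  · exact multipliable_one_sub_X_pow (d := fun p : Fin l × ℕ+ => (p.2 : ℕ)) fun n =>
      (finite_label_le l n).preimage (f := Sum.inl) Sum.inl_injective.injOn
  · exact multipliable_one_sub_X_pow (d := fun n : {n : ℕ // Odd n} => n.1) fun n =>
      (finite_label_le l n).preimage (f := Sum.inr) Sum.inr_injective.injOn

/-! ### Dimensions of the root spaces -/

/-- The weight of an element of the vector crystal: `ε_1, …, ε_l, -ε_l, …, -ε_1`. -/
def wt {l : ℕ} (x : Fin (2 * l)) : Module.Dual ℂ (Cartan l) :=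
  if (x : ℕ) < l then eps l x else -eps l (2 * l - 1 - x)

/-- The basis of the defining representation of `𝔤(C_l)`, as the vector crystal. -/
def index (l : ℕ) : Fin l ⊕ Fin l ≃ Fin (2 * l) :=
  (Equiv.sumCongr (Equiv.refl _) Fin.revPerm).trans
    (finSumFinEquiv.trans (finCongr (two_mul l).symm))

theorem index_inl {l : ℕ} (i : Fin l) : (index l (Sum.inl i) : ℕ) = i := by
  simp [index]

theorem index_inr {l : ℕ} (i : Fin l) : (index l (Sum.inr i) : ℕ) = 2 * l - 1 - i := by
  have := i.2
  simp [index, Fin.val_rev]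
  omega

theorem eps_apply {l i : ℕ} (h : i < l) (t : Cartan l) : eps l i t = t.1 ⟨i, h⟩ := by
  simp [eps, h]

theorem delta_apply {l : ℕ} (t : Cartan l) : delta l t = t.2.2 := rfl

theorem wt_index {l : ℕ} (i : Fin l ⊕ Fin l) (t : Cartan l) :
    wt (index l i) t = Sum.elim t.1 (-t.1) i := by
  rcases i with i | i
  · rw [wt, if_pos (by rw [index_inl]; exact i.2), index_inl, eps_apply i.2]
    rfl
  · have hi := i.2
    rw [wt, if_neg (by rw [index_inr]; omega), index_inr, LinearMap.neg_apply,
      eps_apply (by omega)]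
    simp only [Sum.elim_inr, Pi.neg_apply, neg_inj]
    exact congrArg t.1 (Fin.ext (by simp only; omega))

/-- Since `Jᵀ = -J` and `J² = -1`, skew-adjointness of `M` is symmetry of `MJ`. This is the
identification with the symmetric square, whose coordinates are indexed by pairs `y ≤ x`. -/
theorem mem_sp_iff {l : ℕ} (M : Matrix (Fin l ⊕ Fin l) (Fin l ⊕ Fin l) ℂ) :
    M ∈ LieAlgebra.Symplectic.sp (Fin l) ℂ ↔
      (M * Matrix.J (Fin l) ℂ).transpose = M * Matrix.J (Fin l) ℂ := by
  have hJ := Matrix.J_squared (Fin l) ℂ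
  rw [LieAlgebra.Symplectic.sp, mem_skewAdjointMatricesLieSubalgebra,
    mem_skewAdjointMatricesSubmodule, Matrix.IsSkewAdjoint, Matrix.IsAdjointPair,
    Matrix.transpose_mul, Matrix.J_transpose]
  constructor
  · intro h
    have := congrArg (fun A => Matrix.J (Fin l) ℂ * A * Matrix.J (Fin l) ℂ) h
    simp only [mul_neg, neg_mul, mul_assoc, hJ, mul_one] at this
    simp only [← mul_assoc, hJ, neg_mul, one_mul, neg_neg] at this
    simpa only [neg_mul, mul_assoc] using this
  · intro h
    have := congrArg (fun A => Matrix.J (Fin l) ℂ * A * Matrix.J (Fin l) ℂ) h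
    simp only [mul_neg, neg_mul, mul_assoc, hJ, mul_one] at this
    simp only [← mul_assoc, hJ, neg_mul, one_mul, neg_neg] at this
    rw [this, mul_neg]

/-- The coordinates of an element of `𝔤(C_l)`, identified with the symmetric square of the defining
representation. -/
def spCoord {l : ℕ} (x y : Fin (2 * l)) : Sp l →ₗ[ℂ] ℂ where
  toFun M := (M.1 * Matrix.J (Fin l) ℂ) ((index l).symm x) ((index l).symm y)
  map_add' M N := by simp [add_mul]
  map_smul' c M := by simp

theorem spCoord_comm {l : ℕ} (x y : Fin (2 * l)) (M : Sp l) : spCoord x y M = spCoord y x M :=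
  congrFun (congrFun ((mem_sp_iff M.1).mp M.2) ((index l).symm y)) ((index l).symm x)

theorem eq_of_spCoord {l : ℕ} {M N : Sp l} (h : ∀ x y, spCoord x y M = spCoord x y N) :
    M = N := by
  have hMN : M.1 * Matrix.J (Fin l) ℂ = N.1 * Matrix.J (Fin l) ℂ := by
    ext i j
    simpa [spCoord] using h (index l i) (index l j)
  have := congrArg (· * Matrix.J (Fin l) ℂ) hMN
  simp only [mul_assoc, Matrix.J_squared, mul_neg, mul_one, neg_inj] at this
  exact Subtype.ext this

/-- A diagonal `D = diag(v, -v)` anticommutes with `J`, so `[D, M]J = D(MJ) + (MJ)D`: the weights of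
the two indices add. -/
theorem spCoord_lie_diagSp {l : ℕ} (x y : Fin (2 * l)) (t : Cartan l) (M : Sp l) :
    spCoord x y ⁅diagSp l t.1, M⁆ = (wt x t + wt y t) * spCoord x y M := by
  obtain ⟨i, rfl⟩ := (index l).surjective x
  obtain ⟨j, rfl⟩ := (index l).surjective y
  have hJ : Matrix.diagonal (Sum.elim t.1 (-t.1)) * Matrix.J (Fin l) ℂ =
      -(Matrix.J (Fin l) ℂ * Matrix.diagonal (Sum.elim t.1 (-t.1))) := by
    ext i j
    rcases i with i | i <;> rcases j with j | j <;>
      simp [Matrix.diagonal_mul, Matrix.mul_diagonal, Matrix.J, Matrix.one_apply] <;>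
      by_cases h : i = j <;> simp [h]
  have hS : (⁅diagSp l t.1, M⁆ : Sp l).1 * Matrix.J (Fin l) ℂ =
      Matrix.diagonal (Sum.elim t.1 (-t.1)) * (M.1 * Matrix.J (Fin l) ℂ) +
        (M.1 * Matrix.J (Fin l) ℂ) * Matrix.diagonal (Sum.elim t.1 (-t.1)) := by
    change (Matrix.diagonal (Sum.elim t.1 (-t.1)) * M.1 -
      M.1 * Matrix.diagonal (Sum.elim t.1 (-t.1))) * Matrix.J (Fin l) ℂ = _
    rw [sub_mul, mul_assoc, mul_assoc, mul_assoc, hJ, mul_neg, sub_neg_eq_add]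
  simp only [spCoord, LinearMap.coe_mk, AddHom.coe_mk, hS, Equiv.symm_apply_apply, wt_index,
    Matrix.add_apply, Matrix.diagonal_mul, Matrix.mul_diagonal]
  ring

/-- The element of `𝔤(C_l)` corresponding to the symmetric tensor of `x` and `y`. -/
def spSym {l : ℕ} (x y : Fin (2 * l)) : Sp l :=
  -- The sign compensates `J² = -1`, so that multiplying by `J` again returns the symmetric matrix.
  ⟨-(Matrix.of fun i j => if index l i = x ∧ index l j = y ∨ index l i = y ∧ index l j = x
      then 1 else 0) * Matrix.J (Fin l) ℂ, by
    rw [mem_sp_iff, mul_assoc, Matrix.J_squared, mul_neg, neg_mul, neg_neg, mul_one]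
    ext i j
    simp only [Matrix.transpose_apply, Matrix.of_apply]
    exact if_congr (by tauto) rfl rfl⟩

theorem spCoord_spSym {l : ℕ} (x y x' y' : Fin (2 * l)) :
    spCoord x' y' (spSym x y) = if x' = x ∧ y' = y ∨ x' = y ∧ y' = x then 1 else 0 := by
  simp [spCoord, spSym, mul_assoc, Matrix.J_squared]

theorem loopBracket_single_zero {l : ℕ} (a : Sp l) (f : Loop l) (m : ℤ) :
    loopBracket l (Finsupp.single 0 a) f m = ⁅a, f m⁆ := by
  induction f using Finsupp.induction_linear with
  | zero => simp
  | add f g hf hg => simp only [map_add, Finsupp.add_apply, hf, hg, lie_add]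
  | single n x =>
    rw [loopBracket_single, zero_add, Finsupp.single_apply, Finsupp.single_apply]
    split_ifs <;> simp

theorem cocycle_single_zero {l : ℕ} (a : Sp l) (f : Loop l) :
    cocycle l (Finsupp.single 0 a) f = 0 := by
  induction f using Finsupp.induction_linear with
  | zero => simp
  | add f g hf hg => simp only [map_add, hf, hg, add_zero]
  | single n x => simp

theorem euler_apply {l : ℕ} (f : Loop l) (m : ℤ) : euler l f m = (m : ℂ) • f m := by
  induction f using Finsupp.induction_linear with
  | zero => simp
  | add f g hf hg => simp only [map_add, Finsupp.add_apply, hf, hg, smul_add]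
  | single n x =>
    rw [euler_single, Finsupp.single_apply, Finsupp.single_apply]
    split_ifs with h <;> simp [h]

/-- The coordinates of an element of the affine Lie algebra along `xy ⊗ t^m`. -/
def coord {l : ℕ} (m : ℤ) (x y : Fin (2 * l)) : Aff l →ₗ[ℂ] ℂ where
  toFun X := spCoord x y (X.loop m)
  map_add' X Y := by simp
  map_smul' c X := by simp

theorem coord_apply {l : ℕ} (m : ℤ) (x y : Fin (2 * l)) (X : Aff l) :
    coord m x y X = spCoord x y (X.loop m) := rfl

theorem coord_comm {l : ℕ} (m : ℤ) (x y : Fin (2 * l)) (X : Aff l) :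
    coord m x y X = coord m y x X := spCoord_comm x y _

theorem eq_of_coord {l : ℕ} {X Y : Aff l} (h : ∀ m x y, coord m x y X = coord m x y Y)
    (hc : X.cent = Y.cent) (hd : X.deg = Y.deg) : X = Y :=
  Aff.ext (Finsupp.ext fun m => eq_of_spCoord (h m)) hc hd

theorem coord_lie_cartan {l : ℕ} (m : ℤ) (x y : Fin (2 * l)) (t : Cartan l) (X : Aff l) :
    coord m x y ⁅cartan t, X⁆ = (wt x + wt y + (m : ℂ) • delta l) t * coord m x y X := by
  have h : (⁅cartan t, X⁆ : Aff l).loop m =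
      ⁅diagSp l t.1, X.loop m⁆ + (t.2.2 * (m : ℂ)) • X.loop m := by
    simp [cartan, loopBracket_single_zero, euler_apply, mul_smul]
  rw [coord_apply, h, map_add, spCoord_lie_diagSp, map_smul, coord_apply]
  simp only [LinearMap.add_apply, LinearMap.smul_apply, delta_apply, smul_eq_mul]
  ring

/-- The Cartan subalgebra acts diagonally on the coordinates, while brackets with it have no `c` or
`d` component. For `α ≠ 0` those two components must therefore vanish. -/
theorem mem_rootSpace {l : ℕ} {α : Module.Dual ℂ (Cartan l)} (hα : α ≠ 0) {X : Aff l} :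
    X ∈ rootSpace l α ↔ X.cent = 0 ∧ X.deg = 0 ∧
      ∀ m x y, coord m x y X ≠ 0 → wt x + wt y + (m : ℂ) • delta l = α := by
  change (∀ t : Cartan l, ⁅cartan t, X⁆ = α t • X) ↔ _
  constructor
  · intro h
    obtain ⟨t, ht⟩ : ∃ t, α t ≠ 0 := by
      by_contra! hn
      exact hα (LinearMap.ext hn)
    refine ⟨?_, ?_, fun m x y hX => LinearMap.ext fun t => ?_⟩
    · have := congrArg Aff.cent (h t)
      simpa [cartan, cocycle_single_zero, ht] using this
    · have := congrArg Aff.deg (h t)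
      simpa [ht] using this
    · have := congrArg (coord m x y) (h t)
      rw [coord_lie_cartan, map_smul, smul_eq_mul] at this
      exact mul_right_cancel₀ hX this
  · rintro ⟨hc, hd, h⟩ t
    refine eq_of_coord (fun m x y => ?_) ?_ ?_
    · rw [coord_lie_cartan, map_smul, smul_eq_mul]
      by_cases hX : coord m x y X = 0
      · rw [hX, mul_zero, mul_zero]
      · rw [h m x y hX]
    · simp [hc, cartan, cocycle_single_zero]
    · simp [hd]

/-- The basis of the root space of a nonzero weight `α`: the triples standing for the `xy ⊗ t^m` of
weight `α`. -/
abbrev RootBasis (l : ℕ) (α : Module.Dual ℂ (Cartan l)) : Type :=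
  {p : ℤ × Fin (2 * l) × Fin (2 * l) //
    p.2.2 ≤ p.2.1 ∧ wt p.2.1 + wt p.2.2 + (p.1 : ℂ) • delta l = α}

theorem wt_apply_of_fst_eq_zero {l : ℕ} (x : Fin (2 * l)) (a b : ℂ) :
    wt x ((0, a, b) : Cartan l) = 0 := by
  obtain ⟨i, rfl⟩ := (index l).surjective x
  rw [wt_index]
  rcases i with i | i <;> simp

/-- Evaluation at `d`, the point `(0, 0, 1)`, kills the finite weights and recovers `m` from `α`;
only finitely many pairs remain. -/
instance (l : ℕ) (α : Module.Dual ℂ (Cartan l)) : Finite (RootBasis l α) := by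
  refine Finite.of_injective (fun p : RootBasis l α => p.1.2) fun p q h => ?_
  have hp := LinearMap.congr_fun p.2.2 (0, 0, 1)
  have hq := LinearMap.congr_fun q.2.2 (0, 0, 1)
  simp only [LinearMap.add_apply, wt_apply_of_fst_eq_zero, zero_add, LinearMap.smul_apply,
    delta_apply, smul_eq_mul, mul_one] at hp hq
  refine Subtype.ext (Prod.ext ?_ h)
  exact_mod_cast hp.trans hq.symm

/-- The coordinates of the elements of a root space. -/
def rootCoord (l : ℕ) (α : Module.Dual ℂ (Cartan l)) :
    rootSpace l α →ₗ[ℂ] (RootBasis l α → ℂ) :=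
  LinearMap.pi fun p => (coord p.1.1 p.1.2.1 p.1.2.2).comp (rootSpace l α).subtype

theorem rootCoord_apply {l : ℕ} {α : Module.Dual ℂ (Cartan l)} (X : rootSpace l α)
    (p : RootBasis l α) : rootCoord l α X p = coord p.1.1 p.1.2.1 p.1.2.2 X.1 := rfl

theorem rootCoord_injective {l : ℕ} {α : Module.Dual ℂ (Cartan l)} (hα : α ≠ 0) :
    Function.Injective (rootCoord l α) := by
  rw [injective_iff_map_eq_zero]
  intro X hX
  obtain ⟨hc, hd, h⟩ := (mem_rootSpace hα).mp X.2
  have key (m : ℤ) (x y : Fin (2 * l)) (hyx : y ≤ x) : coord m x y X.1 = 0 := by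
    by_contra hn
    exact hn (congrFun hX ⟨(m, x, y), hyx, h m x y hn⟩)
  refine Subtype.ext (eq_of_coord (fun m x y => ?_) hc hd)
  rw [ZeroMemClass.coe_zero, map_zero]
  rcases le_total y x with hyx | hyx
  · exact key m x y hyx
  · rw [coord_comm]
    exact key m y x hyx

theorem coord_single_spSym {l : ℕ} (m m' : ℤ) (x y x' y' : Fin (2 * l)) :
    coord m' x' y' ⟨Finsupp.single m (spSym x y), 0, 0⟩ =
      if m' = m ∧ (x' = x ∧ y' = y ∨ x' = y ∧ y' = x) then 1 else 0 := by
  rw [coord_apply, Finsupp.single_apply]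
  by_cases h : m = m'
  · simp [h, spCoord_spSym]
  · simp [h, Ne.symm h]

theorem rootCoord_surjective {l : ℕ} {α : Module.Dual ℂ (Cartan l)} (hα : α ≠ 0) :
    Function.Surjective (rootCoord l α) := by
  classical
  have := Fintype.ofFinite (RootBasis l α)
  have key (p : RootBasis l α) : Pi.single p 1 ∈ LinearMap.range (rootCoord l α) := by
    obtain ⟨⟨m, x, y⟩, hyx, hp⟩ := p
    refine ⟨⟨⟨Finsupp.single m (spSym x y), 0, 0⟩, (mem_rootSpace hα).mpr ⟨rfl, rfl, ?_⟩⟩, ?_⟩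
    · intro m' x' y' h
      rw [coord_single_spSym] at h
      obtain ⟨rfl, ⟨rfl, rfl⟩ | ⟨rfl, rfl⟩⟩ := (ite_ne_right_iff.mp h).1
      · exact hp
      · rw [add_comm (wt x')]
        exact hp
    · funext ⟨⟨m', x', y'⟩, hyx', hp'⟩
      rw [rootCoord_apply, coord_single_spSym, Pi.single_apply]
      refine if_congr ?_ rfl rfl
      simp only at hyx hyx'
      rw [Subtype.mk.injEq, Prod.mk.injEq, Prod.mk.injEq]
      constructor
      -- Both pairs are ordered, so the swapped match can occur only on the diagonal.
      · rintro ⟨rfl, h | ⟨rfl, rfl⟩⟩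
        · exact ⟨rfl, h⟩
        · exact ⟨rfl, le_antisymm hyx hyx', le_antisymm hyx' hyx⟩
      · rintro ⟨rfl, h⟩
        exact ⟨rfl, Or.inl h⟩
  rw [← LinearMap.range_eq_top, eq_top_iff]
  intro g _
  rw [pi_eq_sum_univ' g]
  exact Submodule.sum_mem _ fun p _ => Submodule.smul_mem _ _ (key p)

/-- A root space is identified with the space of functions on its basis. -/
def rootSpaceEquiv {l : ℕ} {α : Module.Dual ℂ (Cartan l)} (hα : α ≠ 0) :
    rootSpace l α ≃ₗ[ℂ] (RootBasis l α → ℂ) :=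
  LinearEquiv.ofBijective _ ⟨rootCoord_injective hα, rootCoord_surjective hα⟩

theorem finrank_rootSpace {l : ℕ} {α : Module.Dual ℂ (Cartan l)} (hα : α ≠ 0) :
    Module.finrank ℂ (rootSpace l α) = Nat.card (RootBasis l α) := by
  have := Fintype.ofFinite (RootBasis l α)
  rw [(rootSpaceEquiv hα).finrank_eq, Module.finrank_fintype_fun_eq_card, Nat.card_eq_fintype_card]

theorem rootSpace_ne_bot_iff {l : ℕ} {α : Module.Dual ℂ (Cartan l)} (hα : α ≠ 0) :
    rootSpace l α ≠ ⊥ ↔ Nonempty (RootBasis l α) := by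
  rw [← not_iff_not, not_ne_iff, not_nonempty_iff, ← Submodule.subsingleton_iff_eq_bot,
    (rootSpaceEquiv hα).toEquiv.subsingleton_congr]
  constructor
  · intro h
    by_contra hn
    rw [not_isEmpty_iff] at hn
    obtain ⟨p⟩ := hn
    exact zero_ne_one (congrFun (Subsingleton.elim (0 : RootBasis l α → ℂ) 1) p)
  · intro h
    infer_instance

theorem wt_rev {l : ℕ} (x : Fin (2 * l)) : wt x.rev = -wt x := by
  have hx := x.2
  rw [wt, wt, Fin.val_rev]
  by_cases h : (x : ℕ) < l
  · rw [if_neg (by omega), if_pos h, show 2 * l - 1 - (2 * l - (x + 1)) = (x : ℕ) by omega]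
  · rw [if_pos (by omega), if_neg h, neg_neg, show 2 * l - (x + 1) = 2 * l - 1 - (x : ℕ) by omega]

/-- Reversing the vector crystal negates weights. This is needed because `PosRoot` tests the root
space of `α`, whereas nodes lie in that of `-α`. -/
theorem nonempty_rootBasis_neg {l : ℕ} {α : Module.Dual ℂ (Cartan l)}
    (h : Nonempty (RootBasis l α)) : Nonempty (RootBasis l (-α)) := by
  obtain ⟨⟨m, x, y⟩, hyx, h⟩ := h
  refine ⟨⟨(-m, y.rev, x.rev), Fin.rev_le_rev.mpr hyx, ?_⟩⟩
  rw [wt_rev, wt_rev, ← h]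
  simp only [Int.cast_neg, neg_smul]
  abel

/-! ### The roots of the nodes -/

/-- The positive root whose negative is the weight of the node `xy ⊗ t^{-k}`. -/
def Node.root {l : ℕ} (u : Node l) : Module.Dual ℂ (Cartan l) :=
  (u.k : ℂ) • delta l - wt u.x - wt u.y

theorem VecArrow.wt_eq {l : ℕ} {i : Fin (l + 1)} {p p' : Fin (2 * l)} (h : VecArrow l i p p') :
    wt p' = wt p - simpleRoot l i := by
  obtain ⟨h1, h2⟩ := h
  have hp := p'.2
  rw [simpleRoot, if_neg (by omega)]
  rcases lt_trichotomy ((p : ℕ) + 1) l with hl | hl | hl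
  · rw [if_neg (by omega), wt, wt, if_pos (by omega), if_pos (by omega),
      show (i : ℕ) - 1 = p by omega, show (i : ℕ) = p' by omega, sub_sub_cancel]
  · rw [if_pos (by omega), wt, wt, if_neg (by omega), if_pos (by omega),
      show 2 * l - 1 - (p' : ℕ) = p by omega, show l - 1 = (p : ℕ) by omega, two_smul]
    abel
  · rw [if_neg (by omega), wt, wt, if_neg (by omega), if_neg (by omega),
      show 2 * l - 1 - (p' : ℕ) = i - 1 by omega, show 2 * l - 1 - (p : ℕ) = i by omega]
    abel

theorem TensorArrow.wt_eq {l : ℕ} {i : Fin (l + 1)} {x y x' y' : Fin (2 * l)}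
    (h : TensorArrow l i x y x' y') : wt x' + wt y' = wt x + wt y - simpleRoot l i := by
  rcases h with ⟨_, h, rfl⟩ | ⟨_, rfl, h⟩ <;> rw [h.wt_eq] <;> abel

theorem wt_of_eq_zero {l : ℕ} {x : Fin (2 * l)} (h : (x : ℕ) = 0) : wt x = eps l 0 := by
  have := x.2
  rw [wt, h, if_pos (by omega)]

theorem wt_of_eq_last {l : ℕ} {x : Fin (2 * l)} (h : (x : ℕ) = 2 * l - 1) :
    wt x = -eps l 0 := by
  have := x.2
  rw [wt, h, if_neg (by omega), Nat.sub_self]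

theorem Arrow.root_eq {l : ℕ} {i : Fin (l + 1)} {u v : Node l} (h : Arrow i u v) :
    v.root = u.root + simpleRoot l i := by
  rw [Arrow] at h
  rw [Node.root, Node.root]
  split_ifs at h with hi
  · obtain ⟨h1, h2, h3, h4⟩ := h
    rw [simpleRoot, if_pos hi, h2, h4, wt_of_eq_zero h3, wt_of_eq_last h1, Nat.cast_add,
      Nat.cast_one, add_smul, one_smul, two_smul]
    abel
  · obtain ⟨h1, h2⟩ := h
    rw [h1, sub_sub, h2.wt_eq]
    abel

theorem IsGenerator.root_eq {l : ℕ} {i : Fin (l + 1)} {u : Node l} (h : IsGenerator i u) :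
    u.root = simpleRoot l i := by
  have hx := u.x.2
  have hle := u.le
  rw [Fin.le_def] at hle
  rw [IsGenerator] at h
  rw [Node.root, simpleRoot]
  split_ifs at h with hi
  · obtain ⟨h1, h2, h3⟩ := h
    rw [if_pos hi, h3, wt_of_eq_zero h1, wt_of_eq_zero h2, Nat.cast_one, one_smul, two_smul]
    abel
  · obtain ⟨h1, h2, h3⟩ := h
    rw [if_neg hi, h3, Nat.cast_zero, zero_smul, wt, wt, if_neg (by omega),
      show 2 * l - 1 - (u.x : ℕ) = i - 1 by omega]
    by_cases hl : (i : ℕ) = l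
    · rw [if_pos hl, if_neg (by omega), show 2 * l - 1 - (u.y : ℕ) = l - 1 by omega, hl, two_smul]
      abel
    · rw [if_neg hl, if_pos (by omega), h2]
      abel

theorem latticeElt_add {l : ℕ} (d e : Fin (l + 1) →₀ ℕ) :
    latticeElt l (d + e) = latticeElt l d + latticeElt l e := by
  simp [latticeElt, add_smul, Finset.sum_add_distrib]

theorem latticeElt_single {l : ℕ} (i : Fin (l + 1)) :
    latticeElt l (Finsupp.single i 1) = simpleRoot l i := by
  simp [latticeElt, Finsupp.single_apply]

/-- Along a path from a generator, each `i`-arrow adds `α_i`; the coefficients count the colours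
met, together with the initial generator. -/
theorem exists_latticeElt_eq_root {l : ℕ} (u : Node l) : ∃ d, latticeElt l d = u.root := by
  refine Node.induction (P := fun u => ∃ d, latticeElt l d = u.root) ?_ ?_ u
  · intro i u h
    exact ⟨Finsupp.single i 1, by rw [latticeElt_single, h.root_eq]⟩
  · rintro i u v h ⟨d, hd⟩
    exact ⟨d + Finsupp.single i 1, by rw [latticeElt_add, latticeElt_single, h.root_eq, hd]⟩

/-- The element of the Cartan subalgebra on which all simple roots take the value `1`. -/
def heightCoweight (l : ℕ) : Cartan l := (fun i => l - 1 / 2 - (i : ℕ), 0, 2 * l)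

theorem eps_heightCoweight {l i : ℕ} (h : i < l) :
    eps l i (heightCoweight l) = l - 1 / 2 - i := by
  rw [eps_apply h]
  rfl

theorem simpleRoot_heightCoweight {l : ℕ} (hl : 1 ≤ l) (i : Fin (l + 1)) :
    simpleRoot l i (heightCoweight l) = 1 := by
  have hi := i.2
  rw [simpleRoot]
  split_ifs with h0 h1
  · rw [LinearMap.sub_apply, LinearMap.smul_apply, eps_heightCoweight hl, delta_apply,
      heightCoweight, smul_eq_mul]
    push_cast
    ring
  · rw [LinearMap.smul_apply, eps_heightCoweight (by omega), smul_eq_mul, Nat.cast_sub hl]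
    push_cast
    ring
  · rw [LinearMap.sub_apply, eps_heightCoweight (by omega), eps_heightCoweight (by omega),
      Nat.cast_sub (by omega)]
    push_cast
    ring

theorem latticeElt_heightCoweight {l : ℕ} (hl : 1 ≤ l) (d : Fin (l + 1) →₀ ℕ) :
    latticeElt l d (heightCoweight l) = d.degree := by
  simp [latticeElt, simpleRoot_heightCoweight hl, Finsupp.degree_eq_sum]

theorem latticeElt_ne_zero {l : ℕ} (hl : 1 ≤ l) {d : Fin (l + 1) →₀ ℕ} (hd : d ≠ 0) :
    latticeElt l d ≠ 0 := by
  intro h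
  have := latticeElt_heightCoweight hl d
  rw [h, LinearMap.zero_apply, eq_comm, Nat.cast_eq_zero, Finsupp.degree_eq_zero_iff] at this
  exact hd this

theorem wt_heightCoweight {l : ℕ} (x : Fin (2 * l)) :
    wt x (heightCoweight l) = l - 1 / 2 - (x : ℕ) := by
  have hx := x.2
  rw [wt]
  split_ifs with h
  · rw [eps_heightCoweight h]
  · rw [LinearMap.neg_apply, eps_heightCoweight (by omega), Nat.cast_sub (by omega),
      Nat.cast_sub (by omega)]
    push_cast
    ring

/-- This links the combinatorial label to Lie theory: it is the sum of the coefficients of the root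
in the simple roots. -/
theorem Node.root_heightCoweight {l : ℕ} (u : Node l) :
    u.root (heightCoweight l) = u.height := by
  have h : ((u.height + 2 * l : ℕ) : ℂ) = (u.x + u.y + 1 + 2 * l * u.k : ℕ) :=
    congrArg _ u.height_add
  push_cast at h
  rw [Node.root, LinearMap.sub_apply, LinearMap.sub_apply, LinearMap.smul_apply,
    wt_heightCoweight, wt_heightCoweight, delta_apply, heightCoweight, smul_eq_mul]
  linear_combination -h

/-- The fundamental coweights, on which exactly one simple root does not vanish. -/
def fundamentalCoweight (l : ℕ) (j : Fin (l + 1)) : Cartan l :=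
  if (j : ℕ) = 0 then (0, 0, 1)
  else if (j : ℕ) = l then (fun _ => 1 / 2, 0, 1)
  else (fun i => if (i : ℕ) < j then 1 else 0, 0, 2)

theorem eps_fundamentalCoweight {l i : ℕ} (h : i < l) (j : Fin (l + 1)) :
    eps l i (fundamentalCoweight l j) =
      if (j : ℕ) = 0 then 0 else if (j : ℕ) = l then 1 / 2 else if i < j then 1 else 0 := by
  rw [eps_apply h, fundamentalCoweight]
  split_ifs <;> simp_all

theorem delta_fundamentalCoweight {l : ℕ} (j : Fin (l + 1)) :
    delta l (fundamentalCoweight l j) =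
      if (j : ℕ) = 0 then 1 else if (j : ℕ) = l then 1 else 2 := by
  rw [delta_apply, fundamentalCoweight]
  split_ifs <;> rfl

theorem simpleRoot_fundamentalCoweight {l : ℕ} (hl : 1 ≤ l) (i j : Fin (l + 1)) :
    simpleRoot l i (fundamentalCoweight l j) = if i = j then 1 else 0 := by
  have hi := i.2
  have hj := j.2
  rw [simpleRoot]
  simp only [Fin.ext_iff]
  by_cases h0 : (i : ℕ) = 0
  · rw [if_pos h0, LinearMap.sub_apply, LinearMap.smul_apply, eps_fundamentalCoweight hl,
      delta_fundamentalCoweight, smul_eq_mul]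
    split_ifs <;> first | omega | norm_num
  · by_cases h1 : (i : ℕ) = l
    · rw [if_neg h0, if_pos h1, LinearMap.smul_apply, eps_fundamentalCoweight (by omega),
        smul_eq_mul]
      split_ifs <;> first | omega | norm_num
    · rw [if_neg h0, if_neg h1, LinearMap.sub_apply, eps_fundamentalCoweight (by omega),
        eps_fundamentalCoweight (by omega)]
      split_ifs <;> first | omega | norm_num

/-- The fundamental coweights are dual to the simple roots and read off each coefficient. So
equality of roots as functionals gives equality in `PosRoot`. -/
theorem latticeElt_injective {l : ℕ} (hl : 1 ≤ l) : Function.Injective (latticeElt l) := by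
  intro d e h
  ext j
  have := LinearMap.congr_fun h (fundamentalCoweight l j)
  simpa [latticeElt, simpleRoot_fundamentalCoweight hl] using this

/-- The coefficients of the root of a node in the simple roots. -/
def Node.coeff {l : ℕ} (u : Node l) : Fin (l + 1) →₀ ℕ := (exists_latticeElt_eq_root u).choose

theorem Node.latticeElt_coeff {l : ℕ} (u : Node l) : latticeElt l u.coeff = u.root :=
  (exists_latticeElt_eq_root u).choose_spec

theorem Node.degree_coeff {l : ℕ} (hl : 1 ≤ l) (u : Node l) : u.coeff.degree = u.height := by
  have := latticeElt_heightCoweight hl u.coeff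
  rw [u.latticeElt_coeff, u.root_heightCoweight] at this
  exact_mod_cast this.symm

theorem Node.coeff_ne_zero {l : ℕ} (hl : 1 ≤ l) (u : Node l) : u.coeff ≠ 0 := by
  intro h
  have := u.degree_coeff hl
  rw [h, map_zero] at this
  exact u.height_pos.ne this

/-- A node as an element of the basis of the root space of its weight. -/
def Node.toRootBasis {l : ℕ} (u : Node l) : RootBasis l (-u.root) :=
  ⟨(-u.k, u.x, u.y), u.le, by simp only [Node.root, Int.cast_neg, Int.cast_natCast, neg_smul]; abel⟩

/-- The positive root of a node. -/
def Node.toPosRoot {l : ℕ} (hl : 1 ≤ l) (u : Node l) : PosRoot l :=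
  ⟨u.coeff, u.coeff_ne_zero hl, by
    rw [rootSpace_ne_bot_iff (latticeElt_ne_zero hl (u.coeff_ne_zero hl)), u.latticeElt_coeff,
      ← neg_neg u.root]
    exact nonempty_rootBasis_neg ⟨u.toRootBasis⟩⟩

theorem Node.root_of_toPosRoot_eq {l : ℕ} {hl : 1 ≤ l} {u : Node l} {d : PosRoot l}
    (h : u.toPosRoot hl = d) : u.root = latticeElt l d.1 := by
  rw [← h, ← u.latticeElt_coeff]
  rfl

/-- The nodes with a given positive root form the basis of the root space of its negative. -/
theorem exists_node_of_rootBasis {l : ℕ} (hl : 1 ≤ l) {d : PosRoot l}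
    (p : RootBasis l (-latticeElt l d.1)) : ∃ u : Node l, u.toPosRoot hl = d ∧
      ((-u.k, u.x, u.y) : ℤ × Fin (2 * l) × Fin (2 * l)) = p.1 := by
  obtain ⟨⟨m, x, y⟩, hyx, h⟩ := p
  simp only at hyx h
  have hx := x.2
  have hy := y.2
  have hd : d.1.degree ≠ 0 := by
    rw [Ne, Finsupp.degree_eq_zero_iff]
    exact d.2.1
  -- The weight equation evaluated at the height coweight.
  have hh : (2 * l : ℤ) - 1 - (x : ℕ) - (y : ℕ) + m * (2 * l) = -(d.1.degree : ℤ) := by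
    have := LinearMap.congr_fun h (heightCoweight l)
    rw [LinearMap.add_apply, LinearMap.add_apply, LinearMap.smul_apply, LinearMap.neg_apply,
      latticeElt_heightCoweight hl, wt_heightCoweight, wt_heightCoweight, delta_apply,
      heightCoweight, smul_eq_mul] at this
    rw [← Int.cast_inj (α := ℂ)]
    push_cast
    linear_combination this
  -- If `m ≥ 1`, the left side of `hh` is at least `-(2l - 1) + 2l > 0`, but the right side is
  -- negative. For `m = 0` the same equation gives `x + y ≥ 2l`, the node condition.
  obtain ⟨k, rfl⟩ : ∃ k : ℕ, m = -k := by
    refine ⟨(-m).toNat, ?_⟩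
    by_contra hn
    have : 1 * (2 * l : ℤ) ≤ m * (2 * l) :=
      mul_le_mul_of_nonneg_right (by omega) (by omega)
    omega
  let u : Node l := ⟨x, y, k, hyx, fun hk => by rw [hk] at hh; simp at hh; omega⟩
  have hu : u.root = latticeElt l d.1 := by
    rw [← neg_neg (latticeElt l d.1), ← h]
    simp only [Node.root, u, Int.cast_neg, Int.cast_natCast, neg_smul]
    abel
  exact ⟨u, Subtype.ext (latticeElt_injective hl (u.latticeElt_coeff.trans hu)), rfl⟩

/-- The map from the nodes with a given positive root to the basis of the root space. -/
def fiberToRootBasis {l : ℕ} (hl : 1 ≤ l) (d : PosRoot l) (u : {u : Node l // u.toPosRoot hl = d}) :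
    RootBasis l (-latticeElt l d.1) :=
  ⟨u.1.toRootBasis.1, by rw [← Node.root_of_toPosRoot_eq u.2]; exact u.1.toRootBasis.2⟩

theorem fiberToRootBasis_bijective {l : ℕ} (hl : 1 ≤ l) (d : PosRoot l) :
    Function.Bijective (fiberToRootBasis hl d) := by
  constructor
  · intro u v h
    have h' : ((-(u.1.k : ℤ), u.1.x, u.1.y) : ℤ × Fin (2 * l) × Fin (2 * l)) =
        (-(v.1.k : ℤ), v.1.x, v.1.y) :=
      congrArg Subtype.val h
    simp only [Prod.mk.injEq, neg_inj, Nat.cast_inj] at h'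
    exact Subtype.ext (Node.ext_of_coe (by rw [h'.2.1]) (by rw [h'.2.2]) h'.1)
  · intro p
    obtain ⟨u, hu, hp⟩ := exists_node_of_rootBasis hl p
    exact ⟨⟨u, hu⟩, Subtype.ext hp⟩

theorem finite_fiber {l : ℕ} (hl : 1 ≤ l) (d : PosRoot l) :
    Finite {u : Node l // u.toPosRoot hl = d} :=
  Finite.of_injective _ (fiberToRootBasis_bijective hl d).1

theorem finrank_rootSpace_neg {l : ℕ} (hl : 1 ≤ l) (d : PosRoot l) :
    Module.finrank ℂ (rootSpace l (-latticeElt l d.1)) =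
      Nat.card {u : Node l // u.toPosRoot hl = d} := by
  rw [finrank_rootSpace (neg_ne_zero.mpr (latticeElt_ne_zero hl d.2.1)),
    Nat.card_eq_of_bijective _ (fiberToRootBasis_bijective hl d)]

/-! ### The denominator -/

theorem multipliable_node {l : ℕ} (hl : 1 ≤ l) :
    Multipliable fun u : Node l => 1 - MvPowerSeries.monomial u.coeff (1 : ℂ) := by
  refine multipliable_one_sub_monomial fun n => ?_
  simpa only [Node.degree_coeff hl] using finite_height_le hl n

/-- The nodes are grouped by positive root. Each fibre is finite, its size is the root multiplicity
and its members carry the same monomial, so its product is the corresponding denominator factor. -/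
theorem hasProd_denominatorFactor {l : ℕ} (hl : 1 ≤ l) :
    HasProd (denominatorFactor l)
      (∏' u : Node l, (1 - MvPowerSeries.monomial u.coeff (1 : ℂ))) := by
  -- Regrouping an infinite product over fibres uses regularity, which holds for a product of copies
  -- of `ℂ`.
  have hreg : RegularSpace (MvPowerSeries (Fin (l + 1)) ℂ) :=
    inferInstanceAs (RegularSpace ((Fin (l + 1) →₀ ℕ) → ℂ))
  refine HasProd.sigma ((Equiv.sigmaFiberEquiv (Node.toPosRoot hl)).hasProd_iff.mpr
    (multipliable_node hl).hasProd) fun d => ?_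
  have := finite_fiber hl d
  have := Fintype.ofFinite {u : Node l // u.toPosRoot hl = d}
  have h (u : {u : Node l // u.toPosRoot hl = d}) : u.1.coeff = d.1 := congrArg Subtype.val u.2
  rw [denominatorFactor, finrank_rootSpace_neg hl, Nat.card_eq_fintype_card, ← Finset.card_univ,
    ← Finset.prod_const]
  have key := hasProd_fintype fun u : {u : Node l // u.toPosRoot hl = d} =>
    1 - MvPowerSeries.monomial u.1.coeff (1 : ℂ)
  simp only [h] at key ⊢
  convert key using 2 with u
  simp [h u]

theorem Q_principal {l : ℕ} (hl : 1 ≤ l) :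
    Q l (fun _ => 1) = ∏' u : Node l, (1 - PowerSeries.X ^ u.height : PowerSeries ℂ) := by
  have h := hasProd_specialization (multipliable_node hl).hasProd
  simp only [specialization_one_sub_monomial, Node.degree_coeff hl] at h
  rw [Q, denominator, (hasProd_denominatorFactor hl).tprod_eq, h.tprod_eq]

end AffineC

end

theorem lemmaL (l : ℕ) (hl : 1 ≤ l) :
    (∃! N : AffineC.Node l → ℕ, AffineC.IsSpecializedArray (fun _ => 1) N) ∧
    (∀ N : AffineC.Node l → ℕ, AffineC.IsSpecializedArray (fun _ => 1) N →
      ∃ e : AffineC.Node l ≃ (Fin l × ℕ+) ⊕ {n : ℕ // Odd n},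
        ∀ u, N u = Sum.elim (fun p : Fin l × ℕ+ => (p.2 : ℕ)) (fun n : {n : ℕ // Odd n} => n.1) (e u)) ∧
    Multipliable (AffineC.denominatorFactor l) ∧
    Multipliable (fun i : ℕ+ => (1 - PowerSeries.X ^ (i : ℕ) : PowerSeries ℂ) ^ l) ∧
    Multipliable (fun j : ℕ+ => (1 - PowerSeries.X ^ (2 * (j : ℕ) - 1) : PowerSeries ℂ)) ∧
    AffineC.Q l (fun _ => 1) =
      (∏' i : ℕ+, (1 - PowerSeries.X ^ (i : ℕ) : PowerSeries ℂ) ^ l) *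
        ∏' j : ℕ+, (1 - PowerSeries.X ^ (2 * (j : ℕ) - 1) : PowerSeries ℂ) := by
  refine ⟨⟨AffineC.Node.height, AffineC.isSpecializedArray_height l, fun N hN => hN.eq_height⟩,
    fun N hN => ⟨AffineC.nodeEquiv l hl, fun u => ?_⟩,
    (AffineC.hasProd_denominatorFactor hl).multipliable,
    (AffineC.hasProd_one_sub_X_pow_pow l).multipliable, AffineC.multipliable_one_sub_X_pow_odd, ?_⟩
  · rw [hN.eq_height, AffineC.elim_nodeEquiv]
  · rw [AffineC.Q_principal hl, AffineC.tprod_one_sub_X_pow_height hl]
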